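/- Let $V$ be the complex superspace with basis $v_1,v_2,v_3$, where $v_1,v_3$ are odd and $v_2$ is even; write $\bar 1=\bar 3=1$, $\bar 2=0$ for the parities, $i'=4-i$, $\theta_1=\theta_2=1$, $\theta_3=-1$, and $\kappa=-\tfrac32$. The RTT extended Yangian $X^{\mathrm{rtt}}(\mathfrak{osp}(1|2))$ is the associative $\mathbb{C}$-superalgebra generated by $t^{(r)}_{ij}$ ($1\le i,j\le 3$, $r\ge 1$) of parity $\bar i+\bar j$, with $t_{ij}(u)=\delta_{ij}+\sum_{r\ge1}t^{(r)}_{ij}u^{-r}$, subject to the RTT relation $R(u-v)T_1(u)T_2(v)=T_2(v)T_1(u)R(u-v)$ for the orthosymplectic $R$-matrix $R(u)=\mathrm{I}-\frac{P}{u}+\frac{Q}{u-\kappa}$, that is, to the relations $$[t_{ij}(u),t_{k\ell}(v)]=\frac{(-1)^{\bar i\bar j+\bar i\bar k+\bar j\bar k}}{u-v}\big(t_{kj}(u)t_{i\ell}(v)-t_{kj}(v)t_{i\ell}(u)\big)-\frac{1}{u-v-\kappa}\Big(\delta_{ki'}\sum_{p=1}^{3}(-1)^{\bar i+\bar i\bar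 j+\bar j\bar p}\theta_i\theta_p\,t_{pj}(u)t_{p'\ell}(v)-\delta_{\ell j'}\sum_{p=1}^{3}(-1)^{\bar i\bar k+\bar j\bar k+\bar i\bar p}\theta_{j'}\theta_{p'}\,t_{kp'}(v)t_{ip}(u)\Big)$$ for all $1\le i,j,k,\ell\le 3$, where $[x,y]=xy-(-1)^{|x||y|}yx$ is the supercommutator. Let $T(u)=(t_{ij}(u))=F(u)H(u)E(u)$ be the Gauss decomposition, with $F(u)=(f_{ij}(u))$ lower unitriangular, $H(u)=\mathrm{diag}(h_1(u),h_2(u),h_3(u))$, and $E(u)=(e_{ij}(u))$ upper unitriangular (with entries in $X^{\mathrm{rtt}}(\mathfrak{osp}(1|2))[[u^{-1}]]$), and let $e_{12}^{(1)},f_{21}^{(1)}$ be the coefficients of $u^{-1}$ in $e_{12}(u),f_{21}(u)$. The series $h_i(u)$ are even, the series $e_{12}(u),f_{21}(u)$ are odd, and $f(u-\tfrac12)$ is re-expanded in powers of $u^{-1}$. Then the following relations hold: $$[h_i(u),h_j(v)]=0\qquad(1\le i,j\le 2),$$ $$[h_1(u),e_{12}(v)]=\frac{h_1(u)\,(e_{12}(u)-e_{12}(v))}{u-v},\qquad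 [h_1(u),f_{21}(v)]=\frac{(f_{21}(v)-f_{21}(u))\,h_1(u)}{u-v},$$ $$[h_2(u),e_{12}(v)]=h_2(u)\left(\frac{e_{12}(u)-e_{12}(v)}{u-v}+\frac{e_{12}(v)-e_{12}(u-\frac12)}{u-v-\frac12}\right),$$ $$[h_2(u),f_{21}(v)]=\left(\frac{f_{21}(v)-f_{21}(u)}{u-v}+\frac{f_{21}(u-\frac12)-f_{21}(v)}{u-v-\frac12}\right)h_2(u),$$ $$[e_{12}(u),f_{21}(v)]=\frac{1}{u-v}\left(h_1(u)^{-1}h_2(u)-h_1(v)^{-1}h_2(v)\right),$$ $$[e_{12}(u),e_{12}(v)]=\frac{e_{13}(u)-e_{13}(v)}{u-v}+\frac{e_{12}(u)^2-e_{12}(v)^2}{u-v}+\frac{e_{12}(u)e_{12}(v)-e_{12}(v)e_{12}(u)}{2(u-v)}-\frac{(e_{12}(u)-e_{12}(v))^2}{2(u-v)^2},$$ $$[f_{21}(v),f_{21}(u)]=\frac{f_{31}(v)-f_{31}(u)}{u-v}+\frac{f_{21}(u)^2-f_{21}(v)^2}{u-v}+\frac{f_{21}(v)f_{21}(u)-f_{21}(u)f_{21}(v)}{2(u-v)}-\frac{(f_{21}(v)-f_{21}(u))^2}{2(u-v)^2},$$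 together with the cubic relations $$(u-v-1)(u-v+\tfrac12)e_{12}(u)e_{13}(v)+(u-v+\tfrac12)e_{12}(v)e_{13}(v)-(u-v+\tfrac12)e_{12}(v)e_{13}(u)-(u-v)(u-v+\tfrac32)e_{13}(v)e_{12}(u)+(2u-2v+\tfrac12)e_{13}(u)e_{12}(u)-(u-v)e_{12}(v)e_{12}(u)^2-e_{12}(u)^3=0,$$ $$(u-v-1)(u-v+\tfrac12)f_{31}(v)f_{21}(u)+(u-v+\tfrac12)f_{31}(v)f_{21}(v)-(u-v+\tfrac12)f_{31}(u)f_{21}(v)-(u-v)(u-v+\tfrac32)f_{21}(u)f_{31}(v)+(2u-2v+\tfrac12)f_{21}(u)f_{31}(u)+(u-v)f_{21}(u)^2f_{21}(v)+f_{21}(u)^3=0,$$ where $$e_{13}(u)=-e_{12}(u)^2-[e_{12}(u),e_{12}^{(1)}],\qquad f_{31}(u)=f_{21}(u)^2+[f_{21}(u),f_{21}^{(1)}].$$ Furthermore, the remaining entries of $E(u),F(u),H(u)$ are $$e_{23}(u)=-e_{12}(u-\tfrac12),\qquad f_{32}(u)=f_{21}(u-\tfrac12),\qquad h_3(u)=h_1(u-\tfrac12)^{-1}h_2(u-\tfrac12)h_2(u).$$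 -/

import Mathlib

namespace OSp12

noncomputable section

/-! ### Formal series

A series in `A[[u⁻¹]]` is a `PowerSeries A` whose variable `PowerSeries.X` stands for `u⁻¹`.
Identities in two spectral parameters live in the ring `A((v⁻¹))((u⁻¹))`, which contains
`A[[u⁻¹, v⁻¹]]`, the variables `u, v`, and the expansion in `|u| > |v|` of `1 / (u - v - c)`. -/

/-- `A((v⁻¹))((u⁻¹))`: the outer exponent `m` stands for `u⁻ᵐ`, the inner exponent `n` for `v⁻ⁿ`. -/
abbrev Biseries (A : Type*) [Zero A] : Type _ := HahnSeries ℤ (HahnSeries ℤ A)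

/-- The complex number `c` as a constant series. -/
def scal {A : Type*} [Ring A] [Algebra ℂ A] (c : ℂ) : Biseries A :=
  HahnSeries.C (HahnSeries.C (algebraMap ℂ A c))

/-- The variable `u`. -/
def varU (A : Type*) [Ring A] : Biseries A := HahnSeries.single (-1) 1

/-- The variable `v`. -/
def varV (A : Type*) [Ring A] : Biseries A := HahnSeries.C (HahnSeries.single (-1) 1)

/-- The series `f(u)` as a series in `u, v`. -/
def atU {A : Type*} [Ring A] : PowerSeries A →+* Biseries A :=
  (HahnSeries.ofPowerSeries ℤ (HahnSeries ℤ A)).comp (PowerSeries.map HahnSeries.C)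

/-- The series `f(v)` as a series in `u, v`. -/
def atV {A : Type*} [Ring A] : PowerSeries A →+* Biseries A :=
  HahnSeries.C.comp (HahnSeries.ofPowerSeries ℤ A)

/-- The polynomial `u - v - c`. -/
def diffUV {A : Type*} [Ring A] [Algebra ℂ A] (c : ℂ) : Biseries A :=
  varU A - varV A - scal c

/-- The inverse of `u - v - c`, namely `1 / (u - v - c) = ∑ n, (v + c) ^ n * u ^ (-n - 1)`. -/
def invDiffUV {A : Type*} [Ring A] [Algebra ℂ A] (c : ℂ) : Biseries A :=
  HahnSeries.ofPowerSeries ℤ (HahnSeries ℤ A)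
    (PowerSeries.X * PowerSeries.mk fun n =>
      (HahnSeries.single (-1) 1 + HahnSeries.C (algebraMap ℂ A c)) ^ n)

theorem diffUV_mul_invDiffUV {A : Type*} [Ring A] [Algebra ℂ A] (c : ℂ) :
    (diffUV c * invDiffUV c : Biseries A) = 1 := by
  set a : HahnSeries ℤ A := HahnSeries.single (-1) 1 + HahnSeries.C (algebraMap ℂ A c) with ha
  have hg : PowerSeries.mk (fun n => a ^ n) -
      PowerSeries.C a * (PowerSeries.X * PowerSeries.mk fun n => a ^ n) = 1 := by
    ext1 n
    cases n with
    | zero => simp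
    | succ n => simp [PowerSeries.coeff_one, PowerSeries.coeff_succ_X_mul, pow_succ']
  have hd : (diffUV c : Biseries A) = HahnSeries.single (-1) 1 - HahnSeries.C a := by
    simp [diffUV, varU, varV, scal, ha, sub_sub]
  have hX : (HahnSeries.single (-1) 1 : Biseries A) *
      HahnSeries.ofPowerSeries ℤ (HahnSeries ℤ A) PowerSeries.X = 1 := by
    rw [HahnSeries.ofPowerSeries_X, HahnSeries.single_mul_single]
    simp
  rw [hd, invDiffUV, sub_mul, ← HahnSeries.ofPowerSeries_C (Γ := ℤ) a, ← map_mul, map_mul _ PowerSeries.X,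
    ← mul_assoc, hX, one_mul, ← map_sub, hg, map_one]

theorem invDiffUV_mul_diffUV {A : Type*} [Ring A] [Algebra ℂ A] (c : ℂ) :
    (invDiffUV c * diffUV c : Biseries A) = 1 := by
  set a : HahnSeries ℤ A := HahnSeries.single (-1) 1 + HahnSeries.C (algebraMap ℂ A c) with ha
  have hg : PowerSeries.mk (fun n => a ^ n) -
      PowerSeries.X * (PowerSeries.mk fun n => a ^ n) * PowerSeries.C a = 1 := by
    ext1 n
    cases n with
    | zero => simp
    | succ n => simp [PowerSeries.coeff_one, PowerSeries.coeff_succ_X_mul, pow_succ]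
  have hd : (diffUV c : Biseries A) = HahnSeries.single (-1) 1 - HahnSeries.C a := by
    simp [diffUV, varU, varV, scal, ha, sub_sub]
  have hX : HahnSeries.ofPowerSeries ℤ (HahnSeries ℤ A) PowerSeries.X *
      (HahnSeries.single (-1) 1 : Biseries A) = 1 := by
    rw [HahnSeries.ofPowerSeries_X, HahnSeries.single_mul_single]
    simp
  rw [hd, invDiffUV, mul_sub, ← HahnSeries.ofPowerSeries_C (Γ := ℤ) a, ← map_mul,
    (PowerSeries.commute_X (PowerSeries.mk fun n => a ^ n)).symm.eq, map_mul, mul_assoc, hX,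
    mul_one, ← (PowerSeries.commute_X (PowerSeries.mk fun n => a ^ n)).symm.eq, ← map_sub, hg,
    map_one]

/-- The series `f(u - c)`, re-expanded in `u⁻¹`: the substitution
`u⁻¹ ↦ (u - c)⁻¹ = u⁻¹ (1 - c u⁻¹)⁻¹`. -/
def shift {A : Type*} [Ring A] [Algebra ℂ A] (c : ℂ) (f : PowerSeries A) : PowerSeries A :=
  PowerSeries.mk fun n => ∑ r ∈ Finset.range (n + 1),
    PowerSeries.coeff n
      ((PowerSeries.X * (1 - PowerSeries.C c * PowerSeries.X)⁻¹ : PowerSeries ℂ) ^ r) •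
      PowerSeries.coeff r f

/-- The inverse of a series with constant term `1`. -/
def inv {A : Type*} [Ring A] (f : PowerSeries A) : PowerSeries A := PowerSeries.invOfUnit f 1

/-- The supercommutator `[x, y] = x y - (-1)^{p q} y x` of elements of parities `p` and `q`. -/
def sComm {R : Type*} [Ring R] (p q : ℕ) (x y : R) : R := x * y - (-1) ^ (p * q) * (y * x)

/-! ### The RTT extended Yangian of `osp(1|2)`

The indices `1, 2, 3` are `0, 1, 2 : Fin 3`, and `i' = Fin.rev i`. -/

/-- Parities of the basis vectors of `V`: `v₁, v₃` are odd and `v₂` is even. -/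
def par : Fin 3 → ℕ := ![1, 0, 1]

/-- The signs `θ₁ = θ₂ = 1`, `θ₃ = -1`. -/
def theta : Fin 3 → ℤ := ![1, 1, -1]

/-- `κ = N/2 - m - 1` for `N = m = 1`. -/
def kappa : ℂ := 1 / 2 - 1 - 1

/-- The supercommutator `[t_{ij}(u), t_{kl}(v)]`, where `t_{ij}` has parity `i + j`. -/
def rttLeft {A : Type*} [Ring A] [Algebra ℂ A] (T : Matrix (Fin 3) (Fin 3) (PowerSeries A))
    (i j k l : Fin 3) : Biseries A :=
  sComm (par i + par j) (par k + par l) (atU (T i j)) (atV (T k l))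

/-- The right-hand side of the RTT relation for `[t_{ij}(u), t_{kl}(v)]`, i.e. of the matrix
coefficient `⟨v_i ⊗ v_k | ⋯ | v_j ⊗ v_l⟩` of `R(u - v) T₁(u) T₂(v) = T₂(v) T₁(u) R(u - v)`
for the `R`-matrix `R(u) = 1 - P / u + Q / (u - κ)`. -/
def rttRight {A : Type*} [Ring A] [Algebra ℂ A] (T : Matrix (Fin 3) (Fin 3) (PowerSeries A))
    (i j k l : Fin 3) : Biseries A :=
  (-1) ^ (par i * par j + par i * par k + par j * par k) * invDiffUV 0 *
      (atU (T k j) * atV (T i l) - atV (T k j) * atU (T i l)) -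
    invDiffUV kappa *
      ((if k = i.rev then
          ∑ p : Fin 3, (-1) ^ (par i + par i * par j + par j * par p) *
            ((theta i * theta p : ℤ) : Biseries A) * (atU (T p j) * atV (T p.rev l))
        else 0) -
       (if l = j.rev then
          ∑ p : Fin 3, (-1) ^ (par i * par k + par j * par k + par i * par p) *
            ((theta j.rev * theta p.rev : ℤ) : Biseries A) * (atV (T k p.rev) * atU (T i p))
        else 0))

/-- The free algebra on the symbols `t_{ij}^{(r)}`, `r ≥ 1`; the triple `(i, j, s)` is
`t_{ij}^{(s + 1)}`. -/
abbrev FreeT : Type := FreeAlgebra ℂ (Fin 3 × Fin 3 × ℕ)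

/-- The matrix with entries `t_{ij}(u) = δ_{ij} + ∑_{r ≥ 1} t_{ij}^{(r)} u^{-r}` for given
coefficients `t i j s = t_{ij}^{(s + 1)}`. -/
def tMatrix {A : Type*} [Ring A] (t : Fin 3 → Fin 3 → ℕ → A) :
    Matrix (Fin 3) (Fin 3) (PowerSeries A) :=
  Matrix.of fun i j => (if i = j then 1 else 0) + PowerSeries.X * PowerSeries.mk (t i j)

/-- The defining relations: all coefficients of the RTT relations. -/
inductive Rel : FreeT → FreeT → Prop
  | rtt (i j k l : Fin 3) (m n : ℤ) :
      Rel (((rttLeft (tMatrix fun i j s => FreeAlgebra.ι ℂ (i, j, s)) i j k l).coeff m).coeff n)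
        (((rttRight (tMatrix fun i j s => FreeAlgebra.ι ℂ (i, j, s)) i j k l).coeff m).coeff n)

/-- The RTT extended Yangian `X^rtt(osp(1|2))`. -/
abbrev Yangian : Type := RingQuot Rel

/-- The generator `t_{ij}^{(s + 1)}` of the Yangian. -/
def gen (i j : Fin 3) (s : ℕ) : Yangian :=
  RingQuot.mkAlgHom ℂ Rel (FreeAlgebra.ι ℂ (i, j, s))

/-- The generator matrix `T(u)` of the Yangian. -/
def T : Matrix (Fin 3) (Fin 3) (PowerSeries Yangian) := tMatrix gen

/-- `T = F H E` is the Gauss decomposition of `T`, where `F` is lower unitriangular with entries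
`f₂₁, f₃₁, f₃₂`, `H = diag(h₁, h₂, h₃)`, and `E` is upper unitriangular with entries
`e₁₂, e₁₃, e₂₃`. -/
def IsGauss {A : Type*} [Ring A] (T : Matrix (Fin 3) (Fin 3) (PowerSeries A))
    (f₂₁ f₃₁ f₃₂ h₁ h₂ h₃ e₁₂ e₁₃ e₂₃ : PowerSeries A) : Prop :=
  T = !![1, 0, 0; f₂₁, 1, 0; f₃₁, f₃₂, 1] * !![h₁, 0, 0; 0, h₂, 0; 0, 0, h₃] *
    !![1, e₁₂, e₁₃; 0, 1, e₂₃; 0, 0, 1]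

/-- A matrix of the form `1 + O(u⁻¹)` has a Gauss decomposition. -/
theorem exists_isGauss {A : Type*} [Ring A] (t : Fin 3 → Fin 3 → ℕ → A) :
    ∃ f₂₁ f₃₁ f₃₂ h₁ h₂ h₃ e₁₂ e₁₃ e₂₃ : PowerSeries A,
      IsGauss (tMatrix t) f₂₁ f₃₁ f₃₂ h₁ h₂ h₃ e₁₂ e₁₃ e₂₃ := by
  set M := tMatrix t with hM
  have c0 : ∀ i j, PowerSeries.constantCoeff (M i j) = if i = j then 1 else 0 := by
    intro i j
    by_cases h : i = j <;> simp [hM, tMatrix, h]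
  have mi : ∀ f : PowerSeries A, PowerSeries.constantCoeff f = 1 → f * inv f = 1 := fun f h =>
    PowerSeries.mul_invOfUnit f 1 (by simpa using h)
  have im : ∀ f : PowerSeries A, PowerSeries.constantCoeff f = 1 → inv f * f = 1 := fun f h =>
    PowerSeries.invOfUnit_mul f 1 (by simpa using h)
  set h₁ := M 0 0 with hh₁
  have k1 : PowerSeries.constantCoeff h₁ = 1 := by simp [hh₁, c0]
  set h₂ := M 1 1 - M 1 0 * inv h₁ * M 0 1 with hh₂
  have k2 : PowerSeries.constantCoeff h₂ = 1 := by simp [hh₂, c0]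
  set f₃₂ := (M 2 1 - M 2 0 * inv h₁ * M 0 1) * inv h₂ with hf₃₂
  set e₂₃ := inv h₂ * (M 1 2 - M 1 0 * inv h₁ * M 0 2) with he₂₃
  have a1 : ∀ x, h₁ * (inv h₁ * x) = x := fun x => by rw [← mul_assoc, mi _ k1, one_mul]
  have a2 : ∀ x, x * inv h₁ * h₁ = x := fun x => by rw [mul_assoc, im _ k1, mul_one]
  have b1 : ∀ x, h₂ * (inv h₂ * x) = x := fun x => by rw [← mul_assoc, mi _ k2, one_mul]
  have b2 : ∀ x, x * inv h₂ * h₂ = x := fun x => by rw [mul_assoc, im _ k2, mul_one]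
  refine ⟨M 1 0 * inv h₁, M 2 0 * inv h₁, f₃₂, h₁, h₂,
    M 2 2 - M 2 0 * inv h₁ * M 0 2 - f₃₂ * h₂ * e₂₃, inv h₁ * M 0 1, inv h₁ * M 0 2, e₂₃, ?_⟩
  rw [IsGauss, Matrix.eta_fin_three M]
  simp only [Matrix.mul_fin_three, mul_one, one_mul, mul_zero, zero_mul, add_zero, zero_add,
    a1, a2, hf₃₂, b2, ← hh₁]
  simp only [he₂₃, b1]
  simp [hh₂, mul_assoc]

end

end OSp12

open OSp12

set_option linter.unusedSimpArgs false

/-! ### Gauss coordinates and the RTT relation over a field of scalars -/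

namespace OSp12

/-! Series in `u`, `v` over `A` form an algebra over the field `ℂ((v⁻¹))((u⁻¹))` (`Scalars`), in
which `d = u - v` is a central scalar. After substituting `T = F H E`, each entry of the RTT
relation is an identity between noncommuting Gauss coordinates with coefficients rational in `d`.
Ten entries, involving only the first two rows of `T`, suffice in two parameters: relations already
known move `h₁(u)` and `h₁(v)` to the left, where they are cancelled as units. This gives the
relations of `h₁`, `h₂` with `e₁₂`, of `e₁₂` with `f₂₁` and with itself, and a preliminary cubic
relation. The map `t_{ij} ↦ θ_i θ_j t_{ji}` into the opposite algebra preserves RTT (`Rtt.opp`) and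
turns statements about `E` into statements about `F`.

The rest comes from specializing `v = u - c`. If `f(v) + g(u)`, up to powers of `u⁻¹v⁻¹`, equals
`u⁻¹v⁻¹(u - v - c)` times an element of `A[[u⁻¹, v⁻¹]]`, then `f(u - c) + g(u) = 0`
(`shift_add_eq_zero_of_emb`). The cofactor must be a genuine double power series, because `u - v -
c` is a unit in `Biseries A`. With `c = 1/2` this removes the pole in the relation of `h₂` with
`e₁₂` or `f₂₁` and identifies `e₂₃` and `f₃₂`. With `c = 1` it gives commutativity of the
coefficients of `h₂`, and with `c = -1` it removes the defect of the preliminary cubic relation.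

Commutators with `t₁₂⁽¹⁾` and `t₂₁⁽¹⁾`, read off from the coefficient of `v⁻¹` in RTT
(`rtt_coeff_one`), give `e₁₃`, `f₃₁` and `h₃`. They also give `h₁⁻¹h₂ = 1 - {e₁₂, f₂₁⁽¹⁾}`, so that
`[h₂(u), h₂(v)]` is accessible through the Jacobi identity (`h₂_comm_aux`, `h₂_comm_k`). -/

/-- The nine entries of a Gauss decomposition. -/
structure GaussData (B : Type*) where
  (f₂₁ f₃₁ f₃₂ h₁ h₂ h₃ e₁₂ e₁₃ e₂₃ : B)

/-- The entries of the matrix `F H E`. -/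
def GaussData.entry {B : Type*} [Ring B] (G : GaussData B) : Matrix (Fin 3) (Fin 3) B :=
  !![G.h₁, G.h₁ * G.e₁₂, G.h₁ * G.e₁₃;
    G.f₂₁ * G.h₁, G.f₂₁ * G.h₁ * G.e₁₂ + G.h₂, G.f₂₁ * G.h₁ * G.e₁₃ + G.h₂ * G.e₂₃;
    G.f₃₁ * G.h₁, G.f₃₁ * G.h₁ * G.e₁₂ + G.f₃₂ * G.h₂,
      G.f₃₁ * G.h₁ * G.e₁₃ + G.f₃₂ * G.h₂ * G.e₂₃ + G.h₃]

/-- The RTT relation for two matrices `t = t(u)` and `t' = t(v)` over an algebra whose scalars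
contain `d = u - v`. -/
def Rtt {K B : Type*} [Field K] [Ring B] [Algebra K B] (d : K) (t t' : Matrix (Fin 3) (Fin 3) B) :
    Prop :=
  ∀ i j k l : Fin 3, sComm (par i + par j) (par k + par l) (t i j) (t' k l) =
    ((-1) ^ (par i * par j + par i * par k + par j * par k) * d⁻¹) •
      (t k j * t' i l - t' k j * t i l) -
    (d + 3 / 2)⁻¹ •
      ((if k = i.rev then
          ∑ p : Fin 3, ((-1) ^ (par i + par i * par j + par j * par p) *
            ((theta i * theta p : ℤ) : K)) • (t p j * t' p.rev l)
        else 0) -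
       (if l = j.rev then
          ∑ p : Fin 3, ((-1) ^ (par i * par k + par j * par k + par i * par p) *
            ((theta j.rev * theta p.rev : ℤ) : K)) • (t' k p.rev * t i p)
        else 0))

theorem par_zero : par 0 = 1 := rfl
theorem par_one : par 1 = 0 := rfl
theorem par_two : par 2 = 1 := rfl
theorem theta_zero : theta 0 = 1 := rfl
theorem theta_one : theta 1 = 1 := rfl
theorem theta_two : theta 2 = -1 := rfl
theorem rev_zero : Fin.rev (0 : Fin 3) = 2 := rfl
theorem rev_one : Fin.rev (1 : Fin 3) = 1 := rfl
theorem rev_two : Fin.rev (2 : Fin 3) = 0 := rfl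

section Entries

variable {B : Type*} [Ring B] (G : GaussData B)

theorem GaussData.entry_zero_zero : G.entry 0 0 = G.h₁ := rfl
theorem GaussData.entry_zero_one : G.entry 0 1 = G.h₁ * G.e₁₂ := rfl
theorem GaussData.entry_zero_two : G.entry 0 2 = G.h₁ * G.e₁₃ := rfl
theorem GaussData.entry_one_zero : G.entry 1 0 = G.f₂₁ * G.h₁ := rfl
theorem GaussData.entry_one_one : G.entry 1 1 = G.f₂₁ * G.h₁ * G.e₁₂ + G.h₂ := rfl
theorem GaussData.entry_one_two :
    G.entry 1 2 = G.f₂₁ * G.h₁ * G.e₁₃ + G.h₂ * G.e₂₃ := rfl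

end Entries

/-! ### Relations among Gauss coordinates as linear consequences of RTT -/

section Relations

variable {K B : Type*} [Field K] [CharZero K] [Ring B] [Algebra K B] {d : K} {G G' : GaussData B}

theorem Rtt.rel_zero_zero_zero_zero (H : Rtt d G.entry G'.entry) :
    G.h₁ * G'.h₁ - G'.h₁ * G.h₁ = -(d⁻¹ • (G.h₁ * G'.h₁ - G'.h₁ * G.h₁)) := by
  have r := H 0 0 0 0
  simp only [sComm, par_zero, par_one, par_two, theta_zero, theta_one, theta_two, rev_zero, rev_one,
    rev_two, Fin.sum_univ_three, GaussData.entry_zero_zero, GaussData.entry_zero_one,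
    GaussData.entry_zero_two, GaussData.entry_one_zero, GaussData.entry_one_one,
    GaussData.entry_one_two, Fin.reduceEq, if_true, if_false] at r
  norm_num at r
  linear_combination (norm := module) r

theorem Rtt.rel_zero_zero_zero_one (H : Rtt d G.entry G'.entry) :
    G.h₁ * (G'.h₁ * G'.e₁₂) - G'.h₁ * G'.e₁₂ * G.h₁ =
      -(d⁻¹ • (G.h₁ * (G'.h₁ * G'.e₁₂) - G'.h₁ * (G.h₁ * G.e₁₂))) := by
  have r := H 0 0 0 1
  simp only [sComm, par_zero, par_one, par_two, theta_zero, theta_one, theta_two, rev_zero, rev_one,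
    rev_two, Fin.sum_univ_three, GaussData.entry_zero_zero, GaussData.entry_zero_one,
    GaussData.entry_zero_two, GaussData.entry_one_zero, GaussData.entry_one_one,
    GaussData.entry_one_two, Fin.reduceEq, if_true, if_false] at r
  norm_num at r
  linear_combination (norm := module) r

theorem Rtt.rel_zero_zero_one_zero (H : Rtt d G.entry G'.entry) :
    G.h₁ * (G'.f₂₁ * G'.h₁) - G'.f₂₁ * G'.h₁ * G.h₁ =
      -(d⁻¹ • (G.f₂₁ * G.h₁ * G'.h₁ - G'.f₂₁ * G'.h₁ * G.h₁)) := by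
  have r := H 0 0 1 0
  simp only [sComm, par_zero, par_one, par_two, theta_zero, theta_one, theta_two, rev_zero, rev_one,
    rev_two, Fin.sum_univ_three, GaussData.entry_zero_zero, GaussData.entry_zero_one,
    GaussData.entry_zero_two, GaussData.entry_one_zero, GaussData.entry_one_one,
    GaussData.entry_one_two, Fin.reduceEq, if_true, if_false] at r
  norm_num at r
  linear_combination (norm := module) r

theorem Rtt.rel_zero_zero_one_one (H : Rtt d G.entry G'.entry) :
    G.h₁ * (G'.f₂₁ * G'.h₁ * G'.e₁₂ + G'.h₂) - (G'.f₂₁ * G'.h₁ * G'.e₁₂ + G'.h₂) * G.h₁ =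
      -(d⁻¹ • (G.f₂₁ * G.h₁ * (G'.h₁ * G'.e₁₂) - G'.f₂₁ * G'.h₁ * (G.h₁ * G.e₁₂))) := by
  have r := H 0 0 1 1
  simp only [sComm, par_zero, par_one, par_two, theta_zero, theta_one, theta_two, rev_zero, rev_one,
    rev_two, Fin.sum_univ_three, GaussData.entry_zero_zero, GaussData.entry_zero_one,
    GaussData.entry_zero_two, GaussData.entry_one_zero, GaussData.entry_one_one,
    GaussData.entry_one_two, Fin.reduceEq, if_true, if_false] at r
  norm_num at r
  linear_combination (norm := module) r

theorem Rtt.rel_zero_one_one_zero (H : Rtt d G.entry G'.entry) :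
    G.h₁ * G.e₁₂ * (G'.f₂₁ * G'.h₁) + G'.f₂₁ * G'.h₁ * (G.h₁ * G.e₁₂) =
      d⁻¹ • ((G.f₂₁ * G.h₁ * G.e₁₂ + G.h₂) * G'.h₁ -
        (G'.f₂₁ * G'.h₁ * G'.e₁₂ + G'.h₂) * G.h₁) := by
  have r := H 0 1 1 0
  simp only [sComm, par_zero, par_one, par_two, theta_zero, theta_one, theta_two, rev_zero, rev_one,
    rev_two, Fin.sum_univ_three, GaussData.entry_zero_zero, GaussData.entry_zero_one,
    GaussData.entry_zero_two, GaussData.entry_one_zero, GaussData.entry_one_one,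
    GaussData.entry_one_two, Fin.reduceEq, if_true, if_false] at r
  norm_num at r
  linear_combination (norm := module) r

theorem Rtt.rel_zero_zero_zero_two (H : Rtt d G.entry G'.entry) :
    G.h₁ * (G'.h₁ * G'.e₁₃) - G'.h₁ * G'.e₁₃ * G.h₁ =
      -(d⁻¹ • (G.h₁ * (G'.h₁ * G'.e₁₃) - G'.h₁ * (G.h₁ * G.e₁₃))) -
      (d + 3 / 2)⁻¹ • (G'.h₁ * G'.e₁₃ * G.h₁ + G'.h₁ * G'.e₁₂ * (G.h₁ * G.e₁₂) -
        G'.h₁ * (G.h₁ * G.e₁₃)) := by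
  have r := H 0 0 0 2
  simp only [sComm, par_zero, par_one, par_two, theta_zero, theta_one, theta_two, rev_zero, rev_one,
    rev_two, Fin.sum_univ_three, GaussData.entry_zero_zero, GaussData.entry_zero_one,
    GaussData.entry_zero_two, GaussData.entry_one_zero, GaussData.entry_one_one,
    GaussData.entry_one_two, Fin.reduceEq, if_true, if_false] at r
  norm_num at r
  linear_combination (norm := module) r

theorem Rtt.rel_zero_one_zero_one (H : Rtt d G.entry G'.entry) :
    G.h₁ * G.e₁₂ * (G'.h₁ * G'.e₁₂) + G'.h₁ * G'.e₁₂ * (G.h₁ * G.e₁₂) =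
      -(d⁻¹ • (G.h₁ * G.e₁₂ * (G'.h₁ * G'.e₁₂) - G'.h₁ * G'.e₁₂ * (G.h₁ * G.e₁₂))) -
      (d + 3 / 2)⁻¹ • (G'.h₁ * G'.e₁₃ * G.h₁ + G'.h₁ * G'.e₁₂ * (G.h₁ * G.e₁₂) -
        G'.h₁ * (G.h₁ * G.e₁₃)) := by
  have r := H 0 1 0 1
  simp only [sComm, par_zero, par_one, par_two, theta_zero, theta_one, theta_two, rev_zero, rev_one,
    rev_two, Fin.sum_univ_three, GaussData.entry_zero_zero, GaussData.entry_zero_one,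
    GaussData.entry_zero_two, GaussData.entry_one_zero, GaussData.entry_one_one,
    GaussData.entry_one_two, Fin.reduceEq, if_true, if_false] at r
  norm_num at r
  linear_combination (norm := module) r

theorem Rtt.rel_zero_one_zero_two (H : Rtt d G.entry G'.entry) :
    G.h₁ * G.e₁₂ * (G'.h₁ * G'.e₁₃) - G'.h₁ * G'.e₁₃ * (G.h₁ * G.e₁₂) =
      -(d⁻¹ • (G.h₁ * G.e₁₂ * (G'.h₁ * G'.e₁₃) - G'.h₁ * G'.e₁₂ * (G.h₁ * G.e₁₃))) := by
  have r := H 0 1 0 2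
  simp only [sComm, par_zero, par_one, par_two, theta_zero, theta_one, theta_two, rev_zero, rev_one,
    rev_two, Fin.sum_univ_three, GaussData.entry_zero_zero, GaussData.entry_zero_one,
    GaussData.entry_zero_two, GaussData.entry_one_zero, GaussData.entry_one_one,
    GaussData.entry_one_two, Fin.reduceEq, if_true, if_false] at r
  norm_num at r
  linear_combination (norm := module) r

theorem Rtt.rel_zero_zero_one_two (H : Rtt d G.entry G'.entry) :
    G.h₁ * (G'.f₂₁ * G'.h₁ * G'.e₁₃ + G'.h₂ * G'.e₂₃) -
        (G'.f₂₁ * G'.h₁ * G'.e₁₃ + G'.h₂ * G'.e₂₃) * G.h₁ =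
      -(d⁻¹ • (G.f₂₁ * G.h₁ * (G'.h₁ * G'.e₁₃) - G'.f₂₁ * G'.h₁ * (G.h₁ * G.e₁₃))) -
      (d + 3 / 2)⁻¹ • ((G'.f₂₁ * G'.h₁ * G'.e₁₃ + G'.h₂ * G'.e₂₃) * G.h₁ +
        (G'.f₂₁ * G'.h₁ * G'.e₁₂ + G'.h₂) * (G.h₁ * G.e₁₂) -
        G'.f₂₁ * G'.h₁ * (G.h₁ * G.e₁₃)) := by
  have r := H 0 0 1 2
  simp only [sComm, par_zero, par_one, par_two, theta_zero, theta_one, theta_two, rev_zero, rev_one,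
    rev_two, Fin.sum_univ_three, GaussData.entry_zero_zero, GaussData.entry_zero_one,
    GaussData.entry_zero_two, GaussData.entry_one_zero, GaussData.entry_one_one,
    GaussData.entry_one_two, Fin.reduceEq, if_true, if_false] at r
  norm_num at r
  linear_combination (norm := module) r

theorem Rtt.rel_zero_one_one_one (H : Rtt d G.entry G'.entry) :
    G.h₁ * G.e₁₂ * (G'.f₂₁ * G'.h₁ * G'.e₁₂ + G'.h₂) -
        (G'.f₂₁ * G'.h₁ * G'.e₁₂ + G'.h₂) * (G.h₁ * G.e₁₂) =
      d⁻¹ • ((G.f₂₁ * G.h₁ * G.e₁₂ + G.h₂) * (G'.h₁ * G'.e₁₂) -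
        (G'.f₂₁ * G'.h₁ * G'.e₁₂ + G'.h₂) * (G.h₁ * G.e₁₂)) +
      (d + 3 / 2)⁻¹ • ((G'.f₂₁ * G'.h₁ * G'.e₁₃ + G'.h₂ * G'.e₂₃) * G.h₁ +
        (G'.f₂₁ * G'.h₁ * G'.e₁₂ + G'.h₂) * (G.h₁ * G.e₁₂) -
        G'.f₂₁ * G'.h₁ * (G.h₁ * G.e₁₃)) := by
  have r := H 0 1 1 1
  simp only [sComm, par_zero, par_one, par_two, theta_zero, theta_one, theta_two, rev_zero, rev_one,
    rev_two, Fin.sum_univ_three, GaussData.entry_zero_zero, GaussData.entry_zero_one,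
    GaussData.entry_zero_two, GaussData.entry_one_zero, GaussData.entry_one_one,
    GaussData.entry_one_two, Fin.reduceEq, if_true, if_false] at r
  norm_num at r
  linear_combination (norm := module) r

theorem Rtt.h₁_h₁ (H : Rtt d G.entry G'.entry) (hd : d ≠ 0) (hd1 : d + 1 ≠ 0) :
    G.h₁ * G'.h₁ = G'.h₁ * G.h₁ := by
  have key : (1 + d⁻¹) • (G.h₁ * G'.h₁ - G'.h₁ * G.h₁) = 0 := by
    linear_combination (norm := module) H.rel_zero_zero_zero_zero
  have : (1 + d⁻¹) ≠ 0 := by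
    rw [show 1 + d⁻¹ = (d + 1) / d by field_simp]
    exact div_ne_zero hd1 hd
  exact sub_eq_zero.1 ((smul_eq_zero_iff_right this).1 key)

theorem Rtt.e₁₂_h₁ (H : Rtt d G.entry G'.entry) (hd : d ≠ 0) (hd1 : d + 1 ≠ 0)
    (u' : IsUnit G'.h₁) :
    G'.e₁₂ * G.h₁ = G.h₁ * ((1 + d⁻¹) • G'.e₁₂ - d⁻¹ • G.e₁₂) := by
  refine u'.mul_left_cancel ?_
  linear_combination (norm := skip) (1 + d⁻¹) • (H.h₁_h₁ hd hd1 * G'.e₁₂) -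
    H.rel_zero_zero_zero_one
  simp only [mul_assoc, mul_sub, sub_mul, mul_add, add_mul, mul_smul_comm, smul_mul_assoc]
  module

theorem Rtt.h₁_f₂₁ (H : Rtt d G.entry G'.entry) (hd : d ≠ 0) (hd1 : d + 1 ≠ 0)
    (u' : IsUnit G'.h₁) :
    G.h₁ * G'.f₂₁ = G'.f₂₁ * G.h₁ + d⁻¹ • ((G'.f₂₁ - G.f₂₁) * G.h₁) := by
  refine u'.mul_right_cancel ?_
  linear_combination (norm := skip) H.rel_zero_zero_one_zero -
    (1 + d⁻¹) • (G'.f₂₁ * H.h₁_h₁ hd hd1)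
  simp only [mul_assoc, mul_sub, sub_mul, mul_add, add_mul, mul_smul_comm, smul_mul_assoc]
  module

theorem Rtt.h₁_h₂ (H : Rtt d G.entry G'.entry) (hd : d ≠ 0) (hd1 : d + 1 ≠ 0)
    (u' : IsUnit G'.h₁) : G.h₁ * G'.h₂ = G'.h₂ * G.h₁ := by
  linear_combination (norm := skip) H.rel_zero_zero_one_one -
    H.h₁_f₂₁ hd hd1 u' * (G'.h₁ * G'.e₁₂) + G'.f₂₁ * G'.h₁ * H.e₁₂_h₁ hd hd1 u' -
    (1 + d⁻¹) • (G'.f₂₁ * H.h₁_h₁ hd hd1 * G'.e₁₂)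
  simp only [mul_assoc, mul_sub, sub_mul, mul_add, add_mul, mul_smul_comm, smul_mul_assoc]
  module

/-- `[e₁₂(u), h₁(v)]`, in the form needed to move `h₁(v)` to the left. -/
theorem Rtt.e₁₂_h₁_swap (H' : Rtt (-d) G'.entry G.entry) (hd : d ≠ 0) (hd1 : d - 1 ≠ 0)
    (u : IsUnit G.h₁) :
    G.e₁₂ * G'.h₁ = G'.h₁ * ((1 - d⁻¹) • G.e₁₂ + d⁻¹ • G'.e₁₂) := by
  have h : -d + 1 ≠ 0 := fun h => hd1 (by linear_combination -h)
  rw [H'.e₁₂_h₁ (neg_ne_zero.2 hd) h u, inv_neg]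
  congr 1
  module

theorem Rtt.e₁₂_f₂₁ (H : Rtt d G.entry G'.entry) (H' : Rtt (-d) G'.entry G.entry) (hd : d ≠ 0)
    (hd1 : d + 1 ≠ 0) (hd2 : d - 1 ≠ 0) (u : IsUnit G.h₁) (u' : IsUnit G'.h₁) :
    G.h₁ * (G.e₁₂ * G'.f₂₁ + G'.f₂₁ * G.e₁₂) * G'.h₁ =
      d⁻¹ • (G.h₂ * G'.h₁ - G'.h₂ * G.h₁) := by
  linear_combination (norm := skip) H.rel_zero_one_one_zero +
    H.h₁_f₂₁ hd hd1 u' * (G.e₁₂ * G'.h₁) +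
    (1 + d⁻¹) • (G'.f₂₁ * G.h₁ * H'.e₁₂_h₁_swap hd hd2 u) -
    d⁻¹ • (G'.f₂₁ * G'.h₁ * H.e₁₂_h₁ hd hd1 u') +
    G'.f₂₁ * H.h₁_h₁ hd hd1 * ((1 - d⁻¹ ^ 2) • G.e₁₂ + ((1 + d⁻¹) * d⁻¹) • G'.e₁₂)
  simp only [mul_assoc, mul_sub, sub_mul, mul_add, add_mul, mul_smul_comm, smul_mul_assoc]
  module

/-- The product `h₁(v) e₁₃(v) h₁(u)` occurs in the commutator and again in the `κ`-sum, with total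
coefficient `-(1 - (d + 3/2)⁻¹) = -(d + 1/2)(d + 3/2)⁻¹`. This is the origin of the pole at `d =
-1/2`. -/
theorem Rtt.e₁₃_h₁ (H : Rtt d G.entry G'.entry) (hd : d ≠ 0) (hd1 : d + 1 ≠ 0)
    (hd3 : d + 3 / 2 ≠ 0) (hd5 : d + 1 / 2 ≠ 0) (u' : IsUnit G'.h₁) :
    G'.e₁₃ * G.h₁ = G.h₁ *
      (((d + 3 / 2) * (d + 1 / 2)⁻¹ * (1 + d⁻¹)) • G'.e₁₃ -
        ((d + 1 / 2)⁻¹ * ((d + 3 / 2) * d⁻¹ + 1)) • G.e₁₃ +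
        (d + 1 / 2)⁻¹ • ((1 + d⁻¹) • (G'.e₁₂ * G.e₁₂) - d⁻¹ • (G.e₁₂ * G.e₁₂))) := by
  refine u'.mul_left_cancel ?_
  linear_combination (norm := skip)
    ((d + 3 / 2) * (d + 1 / 2)⁻¹ * (1 + d⁻¹)) • (H.h₁_h₁ hd hd1 * G'.e₁₃) -
    ((d + 3 / 2) * (d + 1 / 2)⁻¹) • H.rel_zero_zero_zero_two +
    (d + 1 / 2)⁻¹ • (G'.h₁ * H.e₁₂_h₁ hd hd1 u' * G.e₁₂)
  simp only [mul_assoc, mul_sub, sub_mul, mul_add, add_mul, mul_smul_comm, smul_mul_assoc]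
  have hd3' : d * 2 + 3 ≠ 0 := fun h => hd3 (by linear_combination h / 2)
  have hd5' : d * 2 + 1 ≠ 0 := fun h => hd5 (by linear_combination h / 2)
  match_scalars <;> field_simp <;> ring

theorem Rtt.e₁₂_e₁₂ (H : Rtt d G.entry G'.entry) (H' : Rtt (-d) G'.entry G.entry) (hd : d ≠ 0)
    (hd1 : d + 1 ≠ 0) (hd2 : d - 1 ≠ 0) (hd3 : d + 3 / 2 ≠ 0) (hd5 : d + 1 / 2 ≠ 0)
    (u : IsUnit G.h₁) (u' : IsUnit G'.h₁) :
    G.e₁₂ * G'.e₁₂ + G'.e₁₂ * G.e₁₂ =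
      d⁻¹ • (G.e₁₃ - G'.e₁₃) + d⁻¹ • (G.e₁₂ ^ 2 - G'.e₁₂ ^ 2) +
        (1 / 2 * d⁻¹) • (G.e₁₂ * G'.e₁₂ - G'.e₁₂ * G.e₁₂) -
        (1 / 2 * d⁻¹ ^ 2) • (G.e₁₂ - G'.e₁₂) ^ 2 := by
  refine (u'.mul u).mul_left_cancel ?_
  -- The factor is fixed by the coefficient of `e₁₂(u) e₁₂(v)`: reordering gives `1 - d⁻²`, while
  -- the claim has `(d - 1)(d + 1/2) d⁻²`.
  linear_combination (norm := skip)
    ((d + 1 / 2) * (d + 1)⁻¹) • (H.rel_zero_one_zero_one -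
      (1 + d⁻¹) • (G.h₁ * H'.e₁₂_h₁_swap hd hd2 u * G'.e₁₂) -
      (1 - d⁻¹ + (d + 3 / 2)⁻¹) • (G'.h₁ * H.e₁₂_h₁ hd hd1 u' * G.e₁₂) -
      (d + 3 / 2)⁻¹ • (G'.h₁ * H.e₁₃_h₁ hd hd1 hd3 hd5 u') -
      (1 + d⁻¹) • (H.h₁_h₁ hd hd1 * (((1 - d⁻¹) • G.e₁₂ + d⁻¹ • G'.e₁₂) * G'.e₁₂)))
  simp only [mul_assoc, mul_sub, sub_mul, mul_add, add_mul, mul_smul_comm, smul_mul_assoc, pow_two]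
  have hd3' : d * 2 + 3 ≠ 0 := fun h => hd3 (by linear_combination h / 2)
  have hd5' : d * 2 + 1 ≠ 0 := fun h => hd5 (by linear_combination h / 2)
  have hd3'' : 2 * d + 3 ≠ 0 := by rwa [mul_comm]
  have hd5'' : 2 * d + 1 ≠ 0 := by rwa [mul_comm]
  match_scalars <;> field_simp <;> ring

/-- RTT alone yields the cubic relation only up to a defect. The defect is `d + 1/2` times a series
in `u` alone, whereas the other side carries `d + 1`; specialization at `v = u + 1` later shows that
this series is zero. -/
theorem Rtt.e₁₂_e₁₃_aux (H : Rtt d G.entry G'.entry) (H' : Rtt (-d) G'.entry G.entry) (hd : d ≠ 0)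
    (hd1 : d + 1 ≠ 0) (hd2 : d - 1 ≠ 0) (hd3 : d + 3 / 2 ≠ 0) (hd5 : d + 1 / 2 ≠ 0)
    (u : IsUnit G.h₁) (u' : IsUnit G'.h₁) :
    (d + 1) • (((d - 1) * (d + 1 / 2)) • (G.e₁₂ * G'.e₁₃) + (d + 1 / 2) • (G'.e₁₂ * G'.e₁₃) -
      (d + 1 / 2) • (G'.e₁₂ * G.e₁₃) - (d * (d + 3 / 2)) • (G'.e₁₃ * G.e₁₂) +
      (2 * d + 1 / 2) • (G.e₁₃ * G.e₁₂) - d • (G'.e₁₂ * G.e₁₂ ^ 2) - G.e₁₂ ^ 3) =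
    (d + 1 / 2) • (G.e₁₃ * G.e₁₂ - G.e₁₂ * G.e₁₃ - (2 : K) • G.e₁₂ ^ 3) := by
  refine (u'.mul u).mul_left_cancel ?_
  linear_combination (norm := skip)
    (d ^ 2 * (d + 1 / 2)) • (H.rel_zero_one_zero_two -
      (1 + d⁻¹) • (G.h₁ * H'.e₁₂_h₁_swap hd hd2 u * G'.e₁₃) +
      (G'.h₁ * H.e₁₃_h₁ hd hd1 hd3 hd5 u' * G.e₁₂) +
      d⁻¹ • (G'.h₁ * H.e₁₂_h₁ hd hd1 u' * G.e₁₃) -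
      (1 + d⁻¹) • (H.h₁_h₁ hd hd1 * (((1 - d⁻¹) • G.e₁₂ + d⁻¹ • G'.e₁₂) * G'.e₁₃)))
  simp only [mul_assoc, mul_sub, sub_mul, mul_add, add_mul, mul_smul_comm, smul_mul_assoc, pow_two,
    pow_succ, pow_zero, one_mul]
  have hd3' : d * 2 + 3 ≠ 0 := fun h => hd3 (by linear_combination h / 2)
  have hd5' : d * 2 + 1 ≠ 0 := fun h => hd5 (by linear_combination h / 2)
  match_scalars <;> field_simp <;> ring

/-- A row reduction: subtracting `f₂₁(v)` times the first-row relation from the second-row relation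
strips the `f₂₁` part of the `κ`-sum, leaving `h₂(v)` as a common left factor to cancel. -/
theorem Rtt.e₂₃_h₁ (H : Rtt d G.entry G'.entry) (hd : d ≠ 0) (hd1 : d + 1 ≠ 0)
    (hd3 : d + 3 / 2 ≠ 0) (hd5 : d + 1 / 2 ≠ 0) (u' : IsUnit G'.h₁) (w' : IsUnit G'.h₂) :
    G'.e₂₃ * G.h₁ = G.h₁ *
      (((d + 3 / 2) * (d + 1 / 2)⁻¹) • G'.e₂₃ + (d + 1 / 2)⁻¹ • G.e₁₂) := by
  refine w'.mul_left_cancel ?_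
  linear_combination (norm := skip)
    -(((d + 3 / 2) * (d + 1 / 2)⁻¹) • (H.rel_zero_zero_one_two -
      G'.f₂₁ * H.rel_zero_zero_zero_two - H.h₁_f₂₁ hd hd1 u' * (G'.h₁ * G'.e₁₃) -
      H.h₁_h₂ hd hd1 u' * G'.e₂₃))
  simp only [mul_assoc, mul_sub, sub_mul, mul_add, add_mul, mul_smul_comm, smul_mul_assoc, mul_neg]
  have hd3' : d * 2 + 3 ≠ 0 := fun h => hd3 (by linear_combination h / 2)
  have hd5' : d * 2 + 1 ≠ 0 := fun h => hd5 (by linear_combination h / 2)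
  match_scalars <;> field_simp <;> ring

/-- The same row reduction, with a plus sign because the two relations carry their `κ`-sums with
opposite signs. The anticommutator of `e₁₂` with `f₂₁` supplies the rest, and the surviving `e₂₃(v)
h₁(u)` is reordered by `e₂₃_h₁`. -/
theorem Rtt.h₂_e₁₂_swap (H : Rtt d G.entry G'.entry) (H' : Rtt (-d) G'.entry G.entry) (hd : d ≠ 0)
    (hd1 : d + 1 ≠ 0) (hd2 : d - 1 ≠ 0) (hd3 : d + 3 / 2 ≠ 0) (hd5 : d + 1 / 2 ≠ 0)
    (u : IsUnit G.h₁) (u' : IsUnit G'.h₁) (w' : IsUnit G'.h₂) :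
    G'.h₂ * G.e₁₂ - G.e₁₂ * G'.h₂ =
      G'.h₂ * (d⁻¹ • (G.e₁₂ - G'.e₁₂) - (d + 1 / 2)⁻¹ • (G.e₁₂ + G'.e₂₃)) := by
  refine u.mul_left_cancel ?_
  linear_combination (norm := skip)
    -(H.rel_zero_one_one_one + G'.f₂₁ * H.rel_zero_one_zero_one -
      H.e₁₂_f₂₁ H' hd hd1 hd2 u u' * G'.e₁₂ + H.h₁_f₂₁ hd hd1 u' * (G.e₁₂ * G'.h₁ * G'.e₁₂) +
      (d + 3 / 2)⁻¹ • (G'.h₂ * H.e₂₃_h₁ hd hd1 hd3 hd5 u' w')) +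
    H.h₁_h₂ hd hd1 u' * (G.e₁₂ - d⁻¹ • (G.e₁₂ - G'.e₁₂) + (d + 1 / 2)⁻¹ • (G.e₁₂ + G'.e₂₃))
  simp only [mul_assoc, mul_sub, sub_mul, mul_add, add_mul, mul_smul_comm, smul_mul_assoc, mul_neg]
  have hd3' : d * 2 + 3 ≠ 0 := fun h => hd3 (by linear_combination h / 2)
  have hd5' : d * 2 + 1 ≠ 0 := fun h => hd5 (by linear_combination h / 2)
  match_scalars <;> field_simp <;> ring

theorem Rtt.h₂_e₁₂ (H : Rtt d G.entry G'.entry) (H' : Rtt (-d) G'.entry G.entry) (hd : d ≠ 0)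
    (hd1 : d + 1 ≠ 0) (hd2 : d - 1 ≠ 0) (hd4 : d - 3 / 2 ≠ 0) (hd6 : d - 1 / 2 ≠ 0)
    (u : IsUnit G.h₁) (w : IsUnit G.h₂) (u' : IsUnit G'.h₁) :
    G.h₂ * G'.e₁₂ - G'.e₁₂ * G.h₂ =
      G.h₂ * (d⁻¹ • (G.e₁₂ - G'.e₁₂) + (d - 1 / 2)⁻¹ • (G'.e₁₂ + G.e₂₃)) := by
  rw [H'.h₂_e₁₂_swap (by rwa [neg_neg]) (neg_ne_zero.2 hd)
    (fun h => hd2 (by linear_combination -h)) (fun h => hd1 (by linear_combination -h))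
    (fun h => hd4 (by linear_combination -h)) (fun h => hd6 (by linear_combination -h)) u' u w,
    show -d + 1 / 2 = -(d - 1 / 2) by ring, inv_neg, inv_neg]
  congr 1
  module

end Relations

/-! ### The transposition anti-automorphism -/

open MulOpposite in
/-- The Gauss data of the image of a matrix under the anti-automorphism
`t_{ij} ↦ θ_i θ_j t_{ji}`. -/
def GaussData.opp {B : Type*} [Ring B] (G : GaussData B) : GaussData Bᵐᵒᵖ where
  f₂₁ := op G.e₁₂
  f₃₁ := op (-G.e₁₃)
  f₃₂ := op (-G.e₂₃)
  h₁ := op G.h₁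
  h₂ := op G.h₂
  h₃ := op G.h₃
  e₁₂ := op G.f₂₁
  e₁₃ := op (-G.f₃₁)
  e₂₃ := op (-G.f₃₂)

theorem GaussData.entry_opp {B : Type*} [Ring B] (G : GaussData B) :
    G.opp.entry = fun i j => ((theta i * theta j : ℤ)) • MulOpposite.op (G.entry j i) := by
  funext i j
  fin_cases i <;> fin_cases j <;>
    simp [GaussData.entry, GaussData.opp, theta, mul_assoc, ← MulOpposite.op_mul]

-- Reversing products in the relation with indices `(j, i, l, k)` exchanges the two `κ`-sums and the
-- two terms of the `d⁻¹` part; the remaining signs are checked on all index quadruples.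
set_option maxHeartbeats 2000000 in
theorem Rtt.opp {K B : Type*} [Field K] [CharZero K] [Ring B] [Algebra K B] {d : K}
    {t t' : Matrix (Fin 3) (Fin 3) B} (H : Rtt d t t') :
    Rtt d (fun i j => ((theta i * theta j : ℤ)) • MulOpposite.op (t j i))
      (fun i j => ((theta i * theta j : ℤ)) • MulOpposite.op (t' j i)) := by
  intro i j k l
  have r := congrArg MulOpposite.op (H j i l k)
  fin_cases i <;> fin_cases j <;> fin_cases k <;> fin_cases l
  all_goals
    simp only [Fin.zero_eta, Fin.mk_one, Fin.reduceFinMk, sComm, par_zero, par_one, par_two,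
      theta_zero, theta_one, theta_two, rev_zero, rev_one,
      rev_two, Fin.sum_univ_three, Fin.reduceEq, if_true, if_false,
      MulOpposite.op_sub, MulOpposite.op_mul, MulOpposite.op_add, MulOpposite.op_smul,
      MulOpposite.op_pow, MulOpposite.op_neg, MulOpposite.op_one, MulOpposite.op_zero] at r ⊢
    norm_num at r ⊢
    -- Reversal negates a commutator but fixes an anticommutator, and the factors `θ` may change the
    -- sign again, so the sign depends on the case.
    first
    | linear_combination (norm := module) r
    | linear_combination (norm := module) -r

/-! ### The substitution `u ↦ u - c` as a ring homomorphism -/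

section Shift

variable {A : Type*} [Ring A] [Algebra ℂ A] (c : ℂ)

/-- The series `(u - c)⁻¹` in powers of `u⁻¹`. -/
noncomputable def invSub : PowerSeries ℂ :=
  PowerSeries.X * (1 - PowerSeries.C c * PowerSeries.X)⁻¹

theorem invSub_mul : invSub c * (1 - PowerSeries.C c * PowerSeries.X) = PowerSeries.X := by
  rw [invSub, mul_assoc, PowerSeries.inv_mul_cancel, mul_one]
  simp

theorem coeff_invSub_pow {n r : ℕ} (h : n < r) : PowerSeries.coeff n (invSub c ^ r) = 0 := by
  rw [invSub, mul_pow, PowerSeries.coeff_X_pow_mul', if_neg (by omega)]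

theorem coeff_shift_of_le {n N : ℕ} (h : n ≤ N) (f : PowerSeries A) :
    PowerSeries.coeff n (shift c f) =
      ∑ r ∈ Finset.range (N + 1), PowerSeries.coeff n (invSub c ^ r) • PowerSeries.coeff r f := by
  rw [shift, PowerSeries.coeff_mk]
  refine Finset.sum_subset (Finset.range_mono (by omega)) fun r _ hr => ?_
  rw [← invSub, coeff_invSub_pow c (by simpa using hr), zero_smul]

theorem coeff_shift (n : ℕ) (f : PowerSeries A) :
    PowerSeries.coeff n (shift c f) =
      ∑ r ∈ Finset.range (n + 1), PowerSeries.coeff n (invSub c ^ r) • PowerSeries.coeff r f :=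
  coeff_shift_of_le c le_rfl f

theorem shift_add (f g : PowerSeries A) : shift c (f + g) = shift c f + shift c g := by
  ext n
  simp [coeff_shift, Finset.sum_add_distrib]

theorem shift_C (a : A) : shift c (PowerSeries.C a) = PowerSeries.C a := by
  ext n
  rw [coeff_shift, Finset.sum_range_succ']
  cases n <;> simp [PowerSeries.coeff_C, PowerSeries.coeff_one]

theorem shift_mul (f g : PowerSeries A) : shift c (f * g) = shift c f * shift c g := by
  ext n
  set F : ℕ × ℕ → A := fun p => PowerSeries.coeff n (invSub c ^ (p.1 + p.2)) •
    (PowerSeries.coeff p.1 f * PowerSeries.coeff p.2 g) with hF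
  set S := Finset.range (n + 1) ×ˢ Finset.range (n + 1) with hS
  -- Since `(u - c)⁻ʳ` starts at `u⁻ʳ`, both sides equal one sum over the full square of exponents:
  -- terms outside the triangle `p.1 + p.2 ≤ n` do not reach `u⁻ⁿ`.
  trans ∑ p ∈ S, F p
  · rw [← Finset.sum_filter_add_sum_filter_not S (fun p => p.1 + p.2 ∈ Finset.range (n + 1)),
      Finset.sum_eq_zero (s := S.filter fun p => ¬ p.1 + p.2 ∈ Finset.range (n + 1)), add_zero,
      ← Finset.sum_fiberwise_of_maps_to (s := S.filter fun p => p.1 + p.2 ∈ Finset.range (n + 1))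
        (t := Finset.range (n + 1)) (g := fun p => p.1 + p.2)
        (fun p hp => (Finset.mem_filter.1 hp).2), coeff_shift]
    · refine Finset.sum_congr rfl fun r hr => ?_
      rw [PowerSeries.coeff_mul, Finset.smul_sum]
      refine Finset.sum_congr ?_ fun p hp => ?_
      · ext p
        simp only [hS, Finset.HasAntidiagonal.mem_antidiagonal, Finset.mem_filter, Finset.mem_product,
          Finset.mem_range] at hr ⊢
        omega
      · rw [hF, ← (Finset.mem_filter.1 hp).2]
    · intro p hp
      have : n < p.1 + p.2 := by
        have := (Finset.mem_filter.1 hp).2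
        simp only [Finset.mem_range] at this
        omega
      rw [hF]
      simp only [coeff_invSub_pow c this, zero_smul]
  · rw [PowerSeries.coeff_mul]
    have h : ∀ p ∈ Finset.HasAntidiagonal.antidiagonal n, PowerSeries.coeff p.1 (shift c f) *
        PowerSeries.coeff p.2 (shift c g) = ∑ q ∈ S, (PowerSeries.coeff p.1 (invSub c ^ q.1) *
          PowerSeries.coeff p.2 (invSub c ^ q.2)) •
          (PowerSeries.coeff q.1 f * PowerSeries.coeff q.2 g) := by
      intro p hp
      have hp' := Finset.HasAntidiagonal.mem_antidiagonal.1 hp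
      rw [coeff_shift_of_le c (show p.1 ≤ n by omega), coeff_shift_of_le c (show p.2 ≤ n by omega),
        Finset.sum_mul_sum, Finset.sum_product]
      refine Finset.sum_congr rfl fun a _ => Finset.sum_congr rfl fun b _ => ?_
      rw [smul_mul_smul_comm]
    rw [Finset.sum_congr rfl h, Finset.sum_comm]
    refine Finset.sum_congr rfl fun q _ => ?_
    rw [← Finset.sum_smul, ← PowerSeries.coeff_mul, ← pow_add]

/-- Re-expansion `f(u) ↦ f(u - c)` as a ring homomorphism. -/
noncomputable def shiftHom : PowerSeries A →+* PowerSeries A where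
  toFun := shift c
  map_one' := by simpa using shift_C c (1 : A)
  map_mul' := shift_mul c
  map_zero' := by simpa using shift_C c (0 : A)
  map_add' := shift_add c

theorem shiftHom_apply (f : PowerSeries A) : shiftHom c f = shift c f := rfl

theorem shift_X : shift c (PowerSeries.X : PowerSeries A) =
    PowerSeries.map (algebraMap ℂ A) (invSub c) := by
  ext n
  rw [coeff_shift_of_le c (show n ≤ n + 1 by omega), Finset.sum_eq_single 1]
  · simp [Algebra.algebraMap_eq_smul_one]
  · intro r _ hr
    simp [PowerSeries.coeff_X, hr]
  · intro h
    simp at h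

theorem shift_X_mul : (1 - algebraMap ℂ (PowerSeries A) c * PowerSeries.X) *
    shift c (PowerSeries.X : PowerSeries A) = PowerSeries.X := by
  have h := congrArg (PowerSeries.map (algebraMap ℂ A)) (invSub_mul c)
  rw [mul_comm] at h
  simpa [shift_X, PowerSeries.algebraMap_apply] using h

end Shift

/-! ### Specialization `v = u - c` of double power series -/

section TwoVariables

variable {A : Type*} [Ring A]

/-- Exchange of the two variables of a double power series. -/
noncomputable def swapHom : PowerSeries (PowerSeries A) →+* PowerSeries (PowerSeries A) where
  toFun F := PowerSeries.mk fun n => PowerSeries.mk fun m =>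
    PowerSeries.coeff n (PowerSeries.coeff m F)
  map_one' := by
    ext n m
    simp only [PowerSeries.coeff_mk, PowerSeries.coeff_one]
    split_ifs <;> simp [PowerSeries.coeff_one, *]
  map_zero' := by ext n m; simp
  map_add' F G := by ext n m; simp
  map_mul' F G := by
    ext n m
    simp only [PowerSeries.coeff_mk, PowerSeries.coeff_mul, map_sum]
    rw [Finset.sum_comm]

theorem coeff_coeff_swapHom (F : PowerSeries (PowerSeries A)) (m n : ℕ) :
    PowerSeries.coeff m (PowerSeries.coeff n (swapHom F)) =
      PowerSeries.coeff n (PowerSeries.coeff m F) := by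
  simp [swapHom]

theorem swapHom_C (f : PowerSeries A) :
    swapHom (PowerSeries.C f) = PowerSeries.map PowerSeries.C f := by
  ext n m
  rw [coeff_coeff_swapHom]
  simp only [PowerSeries.coeff_C, PowerSeries.coeff_map]
  split_ifs <;> simp

theorem swapHom_map_C (f : PowerSeries A) :
    swapHom (PowerSeries.map PowerSeries.C f) = PowerSeries.C f := by
  ext n m
  rw [coeff_coeff_swapHom]
  simp only [PowerSeries.coeff_C, PowerSeries.coeff_map]
  split_ifs <;> simp

theorem map_C_X : PowerSeries.map PowerSeries.C (PowerSeries.X : PowerSeries A) =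
    PowerSeries.X := PowerSeries.map_X _

/-- The specialization `∑ a_{mn} u⁻ᵐ v⁻ⁿ ↦ ∑ a_{mn} u⁻ᵐ⁻ⁿ`. -/
noncomputable def diag : PowerSeries (PowerSeries A) →+ PowerSeries A where
  toFun F := PowerSeries.mk fun n => ∑ p ∈ Finset.HasAntidiagonal.antidiagonal n,
    PowerSeries.coeff p.2 (PowerSeries.coeff p.1 F)
  map_zero' := by ext; simp
  map_add' F G := by ext; simp [Finset.sum_add_distrib]

theorem coeff_diag (F : PowerSeries (PowerSeries A)) (n : ℕ) :
    PowerSeries.coeff n (diag F) = ∑ p ∈ Finset.HasAntidiagonal.antidiagonal n,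
      PowerSeries.coeff p.2 (PowerSeries.coeff p.1 F) := by
  simp [diag]

theorem diag_X_mul (F : PowerSeries (PowerSeries A)) :
    diag (PowerSeries.X * F) = PowerSeries.X * diag F := by
  ext n
  cases n with
  | zero => simp [coeff_diag]
  | succ n =>
    rw [PowerSeries.coeff_succ_X_mul, coeff_diag, coeff_diag,
      Finset.Nat.antidiagonal_succ, Finset.sum_cons, Finset.sum_map]
    simp [PowerSeries.coeff_succ_X_mul]

theorem diag_C_X_mul (F : PowerSeries (PowerSeries A)) :
    diag (PowerSeries.C PowerSeries.X * F) = PowerSeries.X * diag F := by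
  ext n
  cases n with
  | zero => simp [coeff_diag]
  | succ n =>
    rw [PowerSeries.coeff_succ_X_mul, coeff_diag, coeff_diag,
      Finset.Nat.antidiagonal_succ', Finset.sum_cons, Finset.sum_map]
    simp [PowerSeries.coeff_succ_X_mul]

theorem diag_map_C (f : PowerSeries A) : diag (PowerSeries.map PowerSeries.C f) = f := by
  ext n
  rw [coeff_diag, Finset.sum_eq_single (n, 0)]
  · simp
  · rintro ⟨a, b⟩ h1 h2
    have : b ≠ 0 := by
      rintro rfl
      simp only [Finset.HasAntidiagonal.mem_antidiagonal, add_zero] at h1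
      exact h2 (by rw [h1])
    simp [PowerSeries.coeff_C, this]
  · simp

theorem diag_C (f : PowerSeries A) : diag (PowerSeries.C f) = f := by
  ext n
  rw [coeff_diag, Finset.sum_eq_single (0, n)]
  · simp
  · rintro ⟨a, b⟩ h1 h2
    have : a ≠ 0 := by
      rintro rfl
      simp only [Finset.HasAntidiagonal.mem_antidiagonal, zero_add] at h1
      exact h2 (by rw [h1])
    simp [PowerSeries.coeff_C, this]
  · simp

variable [Algebra ℂ A] (c : ℂ)

theorem diag_smul (F : PowerSeries (PowerSeries A)) : diag (c • F) = c • diag F := by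
  ext n
  simp [coeff_diag, Finset.smul_sum]

/-- The specialization `v = u - c` of a double power series in `u⁻¹` and `v⁻¹`. -/
noncomputable def evalSub : PowerSeries (PowerSeries A) →+ PowerSeries A :=
  diag.comp (((shiftHom c).comp swapHom : PowerSeries (PowerSeries A) →+* _) :
    PowerSeries (PowerSeries A) →+ PowerSeries (PowerSeries A))

theorem evalSub_apply (F : PowerSeries (PowerSeries A)) :
    evalSub c F = diag (shift c (swapHom F)) := rfl

theorem shift_map_C (f : PowerSeries A) :
    shift c (PowerSeries.map PowerSeries.C f) = PowerSeries.map PowerSeries.C (shift c f) := by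
  ext n m
  simp only [coeff_shift, PowerSeries.coeff_map, map_sum]
  refine Finset.sum_congr rfl fun r _ => ?_
  simp [PowerSeries.coeff_C]

theorem evalSub_C (f : PowerSeries A) : evalSub c (PowerSeries.C f) = shift c f := by
  rw [evalSub_apply, swapHom_C, shift_map_C, diag_map_C]

theorem evalSub_map_C (f : PowerSeries A) : evalSub c (PowerSeries.map PowerSeries.C f) = f := by
  rw [evalSub_apply, swapHom_map_C, shift_C, diag_C]

theorem evalSub_X_mul (F : PowerSeries (PowerSeries A)) :
    evalSub c (PowerSeries.X * F) = PowerSeries.X * evalSub c F := by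
  rw [evalSub_apply, map_mul, ← map_C_X, swapHom_map_C, shift_mul, shift_C, diag_C_X_mul,
    evalSub_apply]

/-- The denominator-free form of `v⁻¹ = u⁻¹ (1 - c u⁻¹)⁻¹` at `v = u - c`. -/
theorem evalSub_C_X_mul (F : PowerSeries (PowerSeries A)) :
    evalSub c (PowerSeries.C PowerSeries.X * F) -
      c • (PowerSeries.X * evalSub c (PowerSeries.C PowerSeries.X * F)) =
    PowerSeries.X * evalSub c F := by
  rw [evalSub_apply, map_mul, swapHom_C, map_C_X, shift_mul, ← diag_X_mul, ← diag_smul, ← map_sub,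
    evalSub_apply, ← diag_X_mul]
  congr 1
  conv_rhs => rw [← shift_X_mul c]
  rw [sub_mul, sub_mul, one_mul, Algebra.smul_def, mul_assoc, mul_assoc]

/-- The series `u⁻¹ v⁻¹ (u - v - c)`. -/
noncomputable def dPoly : PowerSeries (PowerSeries A) :=
  PowerSeries.C PowerSeries.X - PowerSeries.X - c • (PowerSeries.X * PowerSeries.C PowerSeries.X)

theorem evalSub_smul (b : ℂ) (F : PowerSeries (PowerSeries A)) :
    evalSub c (b • F) = b • evalSub c F := by
  have h1 : swapHom (b • F) = b • swapHom F := by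
    ext n m
    simp [coeff_coeff_swapHom]
  have h2 (H : PowerSeries (PowerSeries A)) : shift c (b • H) = b • shift c H := by
    ext n m
    simp [coeff_shift, Finset.smul_sum, smul_comm b]
  rw [evalSub_apply, h1, h2, diag_smul, evalSub_apply]

/-- The factor `u - v - c` dies at `v = u - c`. Divisibility has content here because the cofactor
is a double power series and can itself be specialized. -/
theorem evalSub_dPoly_mul (F : PowerSeries (PowerSeries A)) : evalSub c (dPoly c * F) = 0 := by
  rw [dPoly, sub_mul, sub_mul, map_sub, map_sub, smul_mul_assoc, evalSub_smul, mul_assoc,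
    evalSub_X_mul, evalSub_X_mul, ← evalSub_C_X_mul]
  abel

/-- Factors `u⁻¹v⁻¹` introduced to clear denominators can be removed after specialization: up to a
unit they become powers of `u⁻¹`, which is not a zero divisor. -/
theorem evalSub_eq_zero_of_X_mul {F : PowerSeries (PowerSeries A)}
    (h : evalSub c (PowerSeries.X * (PowerSeries.C PowerSeries.X * F)) = 0) :
    evalSub c F = 0 := by
  have h1 := evalSub_C_X_mul c F
  rw [evalSub_X_mul] at h
  have h2 : ∀ g : PowerSeries A, PowerSeries.X * g = 0 → g = 0 := fun g hg => by
    ext n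
    simpa [PowerSeries.coeff_succ_X_mul] using congrArg (PowerSeries.coeff (n + 1)) hg
  rw [h2 _ h] at h1
  exact h2 _ (by simpa using h1.symm)

/-- A series `f(v) + g(u)` that is divisible by `u - v - c` vanishes at `v = u - c`. -/
theorem shift_add_eq_zero {f g : PowerSeries A} {F : PowerSeries (PowerSeries A)} (N : ℕ)
    (h : (PowerSeries.X * PowerSeries.C PowerSeries.X) ^ N *
      (PowerSeries.C f + PowerSeries.map PowerSeries.C g) = dPoly c * F) :
    shift c f + g = 0 := by
  have h1 : evalSub c (PowerSeries.C f + PowerSeries.map PowerSeries.C g) = 0 := by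
    have h2 := (congrArg (evalSub c) h).trans (evalSub_dPoly_mul c F)
    clear h
    induction N with
    | zero => simpa using h2
    | succ N ih =>
      refine ih (evalSub_eq_zero_of_X_mul c ?_)
      rwa [pow_succ', mul_assoc, mul_assoc] at h2
  rwa [map_add, evalSub_C, evalSub_map_C] at h1

end TwoVariables

/-! ### Change of coefficients in series of two variables -/

section HahnSeries

theorem hahnSeries_commute {R : Type*} [Ring R] {x y : HahnSeries ℤ R}
    (h : ∀ i j, Commute (x.coeff i) (y.coeff j)) : Commute x y := by
  ext n
  simp_rw [HahnSeries.coeff_mul]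
  refine Finset.sum_bij (fun a _ => a.swap) (fun a ha => ?_) (fun a _ b _ hab => ?_)
    (fun b hb => ⟨b.swap, ?_, b.swap_swap⟩) (fun a _ => h a.1 a.2)
  · simp only [Finset.mem_antidiagonal] at ha ⊢
    exact ⟨ha.2.1, ha.1, by rw [← ha.2.2]; exact add_comm _ _⟩
  · exact Prod.swap_injective hab
  · simp only [Finset.mem_antidiagonal] at hb ⊢
    exact ⟨hb.2.1, hb.1, by rw [← hb.2.2]; exact add_comm _ _⟩

/-- A ring homomorphism applied to the coefficients of a Hahn series. -/
noncomputable def hahnMap {R S : Type*} [Ring R] [Ring S] (φ : R →+* S) :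
    HahnSeries ℤ R →+* HahnSeries ℤ S where
  toFun x := x.map φ
  map_one' := HahnSeries.map_one φ.toMonoidWithZeroHom
  map_zero' := by ext; simp
  map_add' x y := by ext; simp
  map_mul' x y := HahnSeries.map_mul (φ : R →ₙ+* S)

variable {R S : Type*} [Ring R] [Ring S]

theorem coeff_hahnMap (φ : R →+* S) (x : HahnSeries ℤ R) (n : ℤ) :
    (hahnMap φ x).coeff n = φ (x.coeff n) := rfl

theorem hahnMap_single (φ : R →+* S) (n : ℤ) (r : R) :
    hahnMap φ (HahnSeries.single n r) = HahnSeries.single n (φ r) :=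
  HahnSeries.map_single (φ : ZeroHom R S)

theorem hahnMap_C (φ : R →+* S) (r : R) :
    hahnMap φ (HahnSeries.C r) = HahnSeries.C (φ r) := hahnMap_single φ 0 r

theorem hahnMap_ofPowerSeries (φ : R →+* S) (f : PowerSeries R) :
    hahnMap φ (HahnSeries.ofPowerSeries ℤ R f) =
      HahnSeries.ofPowerSeries ℤ S (PowerSeries.map φ f) := by
  ext n
  rw [coeff_hahnMap]
  rcases le_or_gt 0 n with h | h
  · lift n to ℕ using h
    rw [HahnSeries.ofPowerSeries_apply_coeff, HahnSeries.ofPowerSeries_apply_coeff,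
      PowerSeries.coeff_map]
  · rw [HahnSeries.ofPowerSeries_apply, HahnSeries.ofPowerSeries_apply,
      HahnSeries.embDomain_of_notMem_range, HahnSeries.embDomain_of_notMem_range, map_zero] <;>
    · rintro ⟨m, rfl⟩
      simp at h
      omega

/-- A ring homomorphism applied to the coefficients of a series in two variables. -/
noncomputable def biMap (φ : R →+* S) : Biseries R →+* Biseries S := hahnMap (hahnMap φ)

theorem biMap_varU (φ : R →+* S) : biMap φ (varU R) = varU S := by
  simp [biMap, varU, hahnMap_single]

theorem biMap_varV (φ : R →+* S) : biMap φ (varV R) = varV S := by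
  simp [biMap, varV, hahnMap_single, hahnMap_C, -HahnSeries.C_apply]

theorem biMap_atU (φ : R →+* S) (f : PowerSeries R) :
    biMap φ (atU f) = atU (PowerSeries.map φ f) := by
  simp only [biMap, atU, RingHom.comp_apply, hahnMap_ofPowerSeries]
  congr 1
  ext n : 1
  simp [hahnMap_C, -HahnSeries.C_apply]

theorem biMap_atV (φ : R →+* S) (f : PowerSeries R) :
    biMap φ (atV f) = atV (PowerSeries.map φ f) := by
  simp only [biMap, atV, RingHom.comp_apply, hahnMap_ofPowerSeries, hahnMap_C]

variable [Algebra ℂ R] [Algebra ℂ S]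

theorem biMap_scal (φ : R →ₐ[ℂ] S) (c : ℂ) : biMap (φ : R →+* S) (scal c) = scal c := by
  simp [biMap, scal, hahnMap_C, -HahnSeries.C_apply]

theorem biMap_diffUV (φ : R →ₐ[ℂ] S) (c : ℂ) :
    biMap (φ : R →+* S) (diffUV c) = diffUV c := by
  simp [diffUV, biMap_varU, biMap_varV, biMap_scal]

theorem biMap_invDiffUV (φ : R →ₐ[ℂ] S) (c : ℂ) :
    biMap (φ : R →+* S) (invDiffUV c) = invDiffUV c := by
  refine left_inv_eq_right_inv (a := diffUV c) ?_ (diffUV_mul_invDiffUV c)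
  rw [← biMap_diffUV φ, ← map_mul, invDiffUV_mul_diffUV, map_one]

end HahnSeries

/-! ### Series over `A` as an algebra over `ℂ((v⁻¹))((u⁻¹))` -/

/-- The field of scalars `ℂ((v⁻¹))((u⁻¹))`. -/
def Scalars : Type := Biseries ℂ

/-- Working over a field separates the commutative part of each identity, rational in `u - v`, from
the noncommuting series, so that `match_scalars` and `field_simp` apply. -/
noncomputable instance instFieldScalars : Field Scalars :=
  inferInstanceAs (Field (HahnSeries ℤ (HahnSeries ℤ ℂ)))

/-- The identity map of `ℂ((v⁻¹))((u⁻¹))`. -/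
noncomputable def Scalars.toBiseries : Scalars →+* Biseries ℂ where
  toFun x := x
  map_one' := rfl
  map_mul' _ _ := rfl
  map_zero' := rfl
  map_add' _ _ := rfl

/-- The inclusion of `ℂ` into the scalars. -/
noncomputable def Scalars.const : ℂ →+* Scalars where
  toFun c := (scal c : Biseries ℂ)
  map_one' := (HahnSeries.C.comp HahnSeries.C : ℂ →+* Biseries ℂ).map_one
  map_mul' := (HahnSeries.C.comp HahnSeries.C : ℂ →+* Biseries ℂ).map_mul
  map_zero' := (HahnSeries.C.comp HahnSeries.C : ℂ →+* Biseries ℂ).map_zero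
  map_add' := (HahnSeries.C.comp HahnSeries.C : ℂ →+* Biseries ℂ).map_add

/-- The scalar `u - v`. -/
noncomputable def uv : Scalars := (varU ℂ - varV ℂ : Biseries ℂ)

/-- The scalar `u⁻¹ v⁻¹`. -/
noncomputable def invUV : Scalars :=
  (HahnSeries.single 1 (HahnSeries.single 1 1) : Biseries ℂ)

instance instCharZeroScalars : CharZero Scalars :=
  charZero_of_injective_ringHom Scalars.const.injective

section Algebra

variable {A : Type*} [Ring A] [Algebra ℂ A]

/-- Scalars as series with coefficients in `A`. -/
noncomputable def sc : Scalars →+* Biseries A :=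
  (biMap (algebraMap ℂ A)).comp Scalars.toBiseries

noncomputable instance instAlgebraScalars : Algebra Scalars (Biseries A) :=
  RingHom.toAlgebra' sc fun x y =>
    hahnSeries_commute fun i j => hahnSeries_commute fun k l => by
      simp only [sc, RingHom.comp_apply, biMap, coeff_hahnMap]
      exact Algebra.commutes _ _

theorem scalars_smul_def (x : Scalars) (y : Biseries A) : x • y = sc x * y :=
  Algebra.smul_def x y

theorem sc_commutes (x : Scalars) (y : Biseries A) : sc x * y = y * sc x :=
  Algebra.commutes x y

theorem sc_const (c : ℂ) : sc (Scalars.const c) = (scal c : Biseries A) :=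
  biMap_scal (Algebra.ofId ℂ A) c

theorem sc_uv_sub (c : ℂ) : sc (uv - Scalars.const c) = (diffUV c : Biseries A) := by
  rw [map_sub, sc_const, diffUV]
  congr 1
  exact (map_sub (biMap (algebraMap ℂ A)) (varU ℂ) (varV ℂ)).trans
    (by rw [biMap_varU, biMap_varV])

theorem uv_sub_ne_zero (c : ℂ) : uv - Scalars.const c ≠ 0 := by
  intro h
  have h1 := diffUV_mul_invDiffUV (A := ℂ) c
  rw [← sc_uv_sub, h, map_zero, zero_mul] at h1
  exact zero_ne_one h1

theorem sc_inv_uv_sub (c : ℂ) :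
    sc (uv - Scalars.const c)⁻¹ = (invDiffUV c : Biseries A) := by
  refine left_inv_eq_right_inv (a := diffUV c) ?_ (diffUV_mul_invDiffUV c)
  rw [← sc_uv_sub, ← map_mul, inv_mul_cancel₀ (uv_sub_ne_zero c), map_one]

theorem diffUV_mul (c : ℂ) (x : Biseries A) : diffUV c * x = (uv - Scalars.const c) • x := by
  rw [scalars_smul_def, sc_uv_sub]

theorem invDiffUV_mul (c : ℂ) (x : Biseries A) :
    invDiffUV c * x = (uv - Scalars.const c)⁻¹ • x := by
  rw [scalars_smul_def, sc_inv_uv_sub]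

theorem mul_invDiffUV (c : ℂ) (x : Biseries A) :
    x * invDiffUV c = (uv - Scalars.const c)⁻¹ • x := by
  rw [scalars_smul_def, ← sc_inv_uv_sub, sc_commutes]

theorem scal_mul (c : ℂ) (x : Biseries A) : scal c * x = Scalars.const c • x := by
  rw [scalars_smul_def, sc_const]

theorem sc_invUV : sc invUV = (HahnSeries.single 1 (HahnSeries.single 1 1) : Biseries A) := by
  change biMap (algebraMap ℂ A) (HahnSeries.single 1 (HahnSeries.single 1 1)) = _
  rw [biMap, hahnMap_single, hahnMap_single, map_one]

theorem invUV_ne_zero : invUV ≠ 0 := by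
  intro h
  have h1 := sc_invUV (A := ℂ)
  rw [h, map_zero, eq_comm] at h1
  simp at h1

end Algebra

/-! ### Double power series inside series of two variables -/

section Embedding

variable {A : Type*} [Ring A]

/-- The embedding of double power series into series in two variables. -/
noncomputable def emb : PowerSeries (PowerSeries A) →+* Biseries A :=
  (HahnSeries.ofPowerSeries ℤ (HahnSeries ℤ A)).comp
    (PowerSeries.map (HahnSeries.ofPowerSeries ℤ A))

theorem emb_injective :
    Function.Injective (emb : PowerSeries (PowerSeries A) →+* Biseries A) := by
  rw [emb, RingHom.coe_comp]
  exact HahnSeries.ofPowerSeries_injective.comp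
    (PowerSeries.map_injective _ HahnSeries.ofPowerSeries_injective)

theorem emb_map_C (f : PowerSeries A) : emb (PowerSeries.map PowerSeries.C f) = atU f := by
  rw [emb, atU, RingHom.comp_apply, RingHom.comp_apply]
  congr 1
  ext n : 1
  simp only [PowerSeries.coeff_map, HahnSeries.ofPowerSeries_C]

theorem emb_C (f : PowerSeries A) : emb (PowerSeries.C f) = atV f := by
  rw [emb, atV, RingHom.comp_apply, RingHom.comp_apply, PowerSeries.map_C,
    HahnSeries.ofPowerSeries_C]

theorem emb_X : emb (PowerSeries.X : PowerSeries (PowerSeries A)) = HahnSeries.single 1 1 := by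
  rw [emb, RingHom.comp_apply, PowerSeries.map_X, HahnSeries.ofPowerSeries_X]

theorem emb_C_X : emb (PowerSeries.C (PowerSeries.X : PowerSeries A)) =
    HahnSeries.single 0 (HahnSeries.single 1 1) := by
  rw [emb_C, atV, RingHom.comp_apply, HahnSeries.ofPowerSeries_X, HahnSeries.C_apply]

variable [Algebra ℂ A]

theorem emb_X_mul_C_X :
    emb (PowerSeries.X * PowerSeries.C PowerSeries.X : PowerSeries (PowerSeries A)) =
      sc invUV := by
  rw [map_mul, emb_X, emb_C_X, sc_invUV, HahnSeries.single_mul_single, add_zero, one_mul]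

theorem emb_smul (c : ℂ) (F : PowerSeries (PowerSeries A)) :
    emb (c • F) = Scalars.const c • emb F := by
  have h : c • F = PowerSeries.C (PowerSeries.C (algebraMap ℂ A c)) * F := by
    ext n m
    simp only [PowerSeries.coeff_C_mul, PowerSeries.coeff_smul]
    rw [Algebra.smul_def]
  rw [h, map_mul, scalars_smul_def, sc_const, emb_C, atV, RingHom.comp_apply,
    HahnSeries.ofPowerSeries_C, scal]

theorem emb_dPoly (c : ℂ) :
    emb (dPoly c : PowerSeries (PowerSeries A)) = sc (invUV * (uv - Scalars.const c)) := by
  have h : (sc (invUV * uv) : Biseries A) =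
      HahnSeries.single 0 (HahnSeries.single 1 1) - HahnSeries.single 1 1 := by
    have h0 : (sc uv : Biseries A) = varU A - varV A := by
      simpa [diffUV, scal] using sc_uv_sub (A := A) 0
    rw [map_mul, sc_invUV, h0, mul_sub, varU, varV, HahnSeries.C_apply,
      HahnSeries.single_mul_single, HahnSeries.single_mul_single, HahnSeries.single_mul_single]
    simp
  rw [dPoly, map_sub, map_sub, emb_smul, emb_X_mul_C_X, emb_X, emb_C_X, mul_sub, map_sub, h,
    scalars_smul_def, ← map_mul, mul_comm invUV]

theorem emb_dPoly_mul (c : ℂ) (F : PowerSeries (PowerSeries A)) :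
    emb (dPoly c * F) = (invUV * (uv - Scalars.const c)) • emb F := by
  rw [map_mul, emb_dPoly, scalars_smul_def]

theorem emb_X_mul_C_X_mul (F : PowerSeries (PowerSeries A)) :
    emb (PowerSeries.X * PowerSeries.C PowerSeries.X * F) = invUV • emb F := by
  rw [map_mul, emb_X_mul_C_X, scalars_smul_def]

/-- A series `f(v) + g(u)` that is divisible by `u - v - c` vanishes at `v = u - c`. -/
theorem shift_add_eq_zero_of_emb (c : ℂ) {f g : PowerSeries A} (N : ℕ)
    (F : PowerSeries (PowerSeries A))
    (h : invUV ^ N • (atV f + atU g) = (invUV * (uv - Scalars.const c)) • emb F) :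
    shift c f + g = 0 := by
  refine shift_add_eq_zero c (F := F) N (emb_injective ?_)
  rw [emb_dPoly_mul, ← h, map_mul, map_pow, emb_X_mul_C_X, map_add, emb_C, emb_map_C, ← map_pow,
    scalars_smul_def]

end Embedding

/-! ### Polynomial form of RTT and the exchange of `u` and `v` -/

section RttForms

theorem map_map_matrix {R S U : Type*} (t : Matrix (Fin 3) (Fin 3) R) (f : R → S) (g : S → U)
    (h : R → U) (H : ∀ x, g (f x) = h x) : (t.map f).map g = t.map h := by
  ext i j
  exact H _

variable {R : Type*} [Ring R]

/-- The bilinear expression multiplied by `(u - v)⁻¹` in the RTT relation. -/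
def rttP (t t' : Matrix (Fin 3) (Fin 3) R) (i j k l : Fin 3) : R :=
  t k j * t' i l - t' k j * t i l

/-- The bilinear expression multiplied by `(u - v - κ)⁻¹` in the RTT relation. -/
def rttQ (t t' : Matrix (Fin 3) (Fin 3) R) (i j k l : Fin 3) : R :=
  (if k = i.rev then
      ∑ p : Fin 3, (-1) ^ (par i + par i * par j + par j * par p) *
        ((theta i * theta p : ℤ) : R) * (t p j * t' p.rev l)
    else 0) -
   (if l = j.rev then
      ∑ p : Fin 3, (-1) ^ (par i * par k + par j * par k + par i * par p) *
        ((theta j.rev * theta p.rev : ℤ) : R) * (t' k p.rev * t i p)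
    else 0)

/-- The sign in front of the first term of the RTT relation. -/
def rttSign (i j k : Fin 3) : ℤ := (-1) ^ (par i * par j + par i * par k + par j * par k)

theorem map_rttP {S : Type*} [Ring S] (φ : R →+* S) (t t' : Matrix (Fin 3) (Fin 3) R)
    (i j k l : Fin 3) :
    φ (rttP t t' i j k l) = rttP (t.map φ) (t'.map φ) i j k l := by
  simp [rttP]

theorem map_rttQ {S : Type*} [Ring S] (φ : R →+* S) (t t' : Matrix (Fin 3) (Fin 3) R)
    (i j k l : Fin 3) :
    φ (rttQ t t' i j k l) = rttQ (t.map φ) (t'.map φ) i j k l := by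
  simp only [rttQ, map_sub, apply_ite φ, map_sum, map_mul, map_pow, map_neg, map_one, map_intCast,
    map_zero, Matrix.map_apply]

theorem map_sComm {S : Type*} [Ring S] (φ : R →+* S) (p q : ℕ) (x y : R) :
    φ (sComm p q x y) = sComm p q (φ x) (φ y) := by
  simp [sComm]

theorem rtt_iff {K B : Type*} [Field K] [Ring B] [Algebra K B] {d : K}
    {t t' : Matrix (Fin 3) (Fin 3) B} : Rtt d t t' ↔ ∀ i j k l : Fin 3,
      sComm (par i + par j) (par k + par l) (t i j) (t' k l) =
        ((rttSign i j k : K) * d⁻¹) • rttP t t' i j k l - (d + 3 / 2)⁻¹ • rttQ t t' i j k l := by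
  have h (n : ℕ) (z : ℤ) (x : B) : (-1 : B) ^ n * (z : B) * x = ((-1 : K) ^ n * (z : K)) • x := by
    simp [Algebra.smul_def]
  simp only [Rtt, rttP, rttQ, rttSign, h, Int.cast_pow, Int.cast_neg, Int.cast_one]

end RttForms

section RttSeries

variable {A : Type*} [Ring A] (t : Matrix (Fin 3) (Fin 3) (PowerSeries A))

theorem map_emb_map_C :
    (t.map (PowerSeries.map PowerSeries.C)).map (emb : _ →+* Biseries A) = t.map atU :=
  map_map_matrix _ _ _ _ emb_map_C

theorem map_emb_C : (t.map PowerSeries.C).map (emb : _ →+* Biseries A) = t.map atV :=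
  map_map_matrix _ _ _ _ emb_C

theorem map_swapHom_map_C :
    (t.map (PowerSeries.map PowerSeries.C)).map (swapHom : _ →+* PowerSeries (PowerSeries A)) =
      t.map PowerSeries.C :=
  map_map_matrix _ _ _ _ swapHom_map_C

theorem map_swapHom_C :
    (t.map PowerSeries.C).map (swapHom : _ →+* PowerSeries (PowerSeries A)) =
      t.map (PowerSeries.map PowerSeries.C) :=
  map_map_matrix _ _ _ _ swapHom_C

end RttSeries

section RttSeries

variable {A : Type*} [Ring A] [Algebra ℂ A] {t : Matrix (Fin 3) (Fin 3) (PowerSeries A)}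

theorem uv_eq : uv = uv - Scalars.const 0 := by simp

theorem uv_add_eq : uv + 3 / 2 = uv - Scalars.const kappa := by
  rw [kappa, map_sub, map_sub, map_div₀, map_one, map_ofNat]
  ring

theorem rtt_of_rttLeft_eq (h : ∀ i j k l, rttLeft t i j k l = rttRight t i j k l) :
    Rtt uv (t.map atU) (t.map atV) := by
  rw [rtt_iff]
  intro i j k l
  simp only [Matrix.map_apply]
  refine (h i j k l).trans ?_
  change (-1) ^ _ * invDiffUV 0 * rttP (t.map atU) (t.map atV) i j k l -
    invDiffUV kappa * rttQ (t.map atU) (t.map atV) i j k l = _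
  rw [mul_assoc, invDiffUV_mul, invDiffUV_mul, ← uv_add_eq, ← uv_eq, mul_smul]
  congr 1
  simp [Algebra.smul_def, rttSign]

/-- The RTT relation for double power series, with denominators cleared. -/
theorem rtt_cleared (h : Rtt uv (t.map atU) (t.map atV))
    (i j k l : Fin 3) :
    dPoly 0 * (dPoly kappa * sComm (par i + par j) (par k + par l)
        (PowerSeries.map PowerSeries.C (t i j)) (PowerSeries.C (t k l))) =
      PowerSeries.X * PowerSeries.C PowerSeries.X *
        (rttSign i j k • (dPoly kappa * rttP (t.map (PowerSeries.map PowerSeries.C))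
          (t.map PowerSeries.C) i j k l) -
        dPoly 0 * rttQ (t.map (PowerSeries.map PowerSeries.C))
          (t.map PowerSeries.C) i j k l) := by
  apply emb_injective
  simp only [emb_dPoly_mul, emb_X_mul_C_X_mul, map_sub, map_sComm, map_rttP, map_rttQ, map_zsmul,
    emb_map_C, emb_C, map_emb_map_C, map_emb_C]
  rw [rtt_iff] at h
  have h1 := h i j k l
  simp only [Matrix.map_apply] at h1
  rw [h1, ← uv_add_eq, map_zero, sub_zero]
  have h2 : uv ≠ 0 := by rw [uv_eq]; exact uv_sub_ne_zero 0
  have h3 : uv + 3 / 2 ≠ 0 := by rw [uv_add_eq]; exact uv_sub_ne_zero _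
  generalize rttP (t.map atU) (t.map atV) i j k l = P
  generalize rttQ (t.map atU) (t.map atV) i j k l = Q
  generalize uv + 3 / 2 = a at *
  rw [← Int.cast_smul_eq_zsmul Scalars]
  match_scalars <;> field_simp

/-- The scalar factor of `swapHom (dPoly c)`. -/
theorem emb_swapHom_dPoly_mul (c : ℂ) (F : PowerSeries (PowerSeries A)) :
    emb (swapHom (dPoly c) * F) = (invUV * (-uv - Scalars.const c)) • emb F := by
  -- The exchange sends `u - v - c` to `v - u - c = -(u - v + c)`.
  have h : swapHom (dPoly c : PowerSeries (PowerSeries A)) = -dPoly (-c) := by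
    have h0 : c • (PowerSeries.X * PowerSeries.C PowerSeries.X : PowerSeries (PowerSeries A)) =
        PowerSeries.C (PowerSeries.C (algebraMap ℂ A c)) *
          (PowerSeries.X * PowerSeries.C PowerSeries.X) := by
      ext n m
      simp only [PowerSeries.coeff_C_mul, PowerSeries.coeff_smul]
      rw [Algebra.smul_def]
    have h1 : swapHom (PowerSeries.X : PowerSeries (PowerSeries A)) =
        PowerSeries.C PowerSeries.X := by
      rw [← map_C_X, swapHom_map_C]
    have h2 : (PowerSeries.C PowerSeries.X * PowerSeries.X : PowerSeries (PowerSeries A)) =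
        PowerSeries.X * PowerSeries.C PowerSeries.X := PowerSeries.commute_X _
    rw [dPoly, dPoly, neg_smul, h0, map_sub, map_sub, map_mul, map_mul, swapHom_C, swapHom_C,
      map_C_X, h1, PowerSeries.map_C, h2]
    abel
  rw [h, neg_mul, map_neg, emb_dPoly_mul, map_neg]
  module

/-- Expansion in `|u| > |v|` is not symmetric, so the variables cannot be exchanged in `Biseries A`.
The relation with denominators cleared lives in `A[[u⁻¹, v⁻¹]]`, where the exchange is a ring
homomorphism; the denominators are then divided out again in the original expansion. -/
theorem rtt_swap (h : Rtt uv (t.map atU) (t.map atV)) :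
    Rtt (-uv) (t.map atV) (t.map atU) := by
  rw [rtt_iff]
  intro i j k l
  simp only [Matrix.map_apply]
  have h1 := congrArg (fun F => emb (swapHom F)) (rtt_cleared h i j k l)
  have hX : swapHom (PowerSeries.X * PowerSeries.C PowerSeries.X : PowerSeries (PowerSeries A)) =
      PowerSeries.X * PowerSeries.C PowerSeries.X := by
    rw [map_mul, swapHom_C, map_C_X, ← map_C_X, swapHom_map_C, map_C_X]
    exact PowerSeries.commute_X _
  simp only [map_mul swapHom (dPoly _), map_mul swapHom (PowerSeries.X * _), hX,
    emb_swapHom_dPoly_mul, emb_X_mul_C_X_mul, map_sub, map_sComm, map_rttP, map_rttQ, map_zsmul,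
    swapHom_C, swapHom_map_C, emb_map_C, emb_C, map_swapHom_C,
    map_swapHom_map_C, map_emb_map_C, map_emb_C, map_zero, sub_zero] at h1
  have h2 : uv ≠ 0 := by rw [uv_eq]; exact uv_sub_ne_zero 0
  have h3 : -uv + 3 / 2 ≠ 0 := by
    have := uv_sub_ne_zero (3 / 2)
    rw [map_div₀, map_ofNat, map_ofNat] at this
    exact fun h => this (by linear_combination -h)
  have h4 : -uv - Scalars.const kappa = -uv + 3 / 2 := by
    rw [kappa, map_sub, map_sub, map_div₀, map_one, map_ofNat]
    ring
  rw [h4] at h1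
  generalize rttP (t.map atV) (t.map atU) i j k l = P at *
  generalize rttQ (t.map atV) (t.map atU) i j k l = Q at *
  generalize -uv + 3 / 2 = a at *
  rw [← Int.cast_smul_eq_zsmul Scalars] at h1
  have h5 := congrArg (fun x => ((invUV * -uv)⁻¹ * (invUV * a)⁻¹) • x) h1
  have h6 := invUV_ne_zero
  linear_combination (norm := skip) h5
  match_scalars <;> field_simp <;> ring

end RttSeries

/-! ### Commutators with the first coefficients of `T` -/

section Coefficients

variable {A : Type*} [Ring A] [Algebra ℂ A] {t : Matrix (Fin 3) (Fin 3) (PowerSeries A)}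

theorem sComm_eq_zsmul {R : Type*} [Ring R] (p q : ℕ) (x y : R) :
    sComm p q x y = x * y - ((-1) ^ (p * q) : ℤ) • (y * x) := by
  simp [sComm]

theorem coeff_one_mul' {R : Type*} [Ring R] (f g : PowerSeries R) :
    PowerSeries.coeff 1 (f * g) = PowerSeries.constantCoeff f * PowerSeries.coeff 1 g +
      PowerSeries.coeff 1 f * PowerSeries.constantCoeff g := by
  rw [PowerSeries.coeff_mul, Finset.Nat.antidiagonal_succ]
  simp

theorem X_mul_cancel {R : Type*} [Ring R] {f g : PowerSeries R}
    (h : PowerSeries.X * f = PowerSeries.X * g) : f = g := by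
  ext n
  simpa [PowerSeries.coeff_succ_X_mul] using congrArg (PowerSeries.coeff (n + 1)) h

/-- The commutation relations with the first coefficients `t_{kl}^{(1)}`. -/
theorem rtt_coeff_one (h : Rtt uv (t.map atU) (t.map atV))
    (h1 : ∀ i j, PowerSeries.constantCoeff (t i j) = (1 : Matrix (Fin 3) (Fin 3) A) i j)
    (i j k l : Fin 3) :
    sComm (par i + par j) (par k + par l) (t i j)
        (PowerSeries.C (PowerSeries.coeff 1 (t k l))) =
      rttQ t 1 i j k l - rttSign i j k • rttP t 1 i j k l := by
  have e := congrArg swapHom (rtt_cleared h i j k l)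
  have hX : swapHom (PowerSeries.X : PowerSeries (PowerSeries A)) = PowerSeries.C PowerSeries.X := by
    rw [← map_C_X, swapHom_map_C]
  have hX' : swapHom (PowerSeries.C (PowerSeries.X : PowerSeries A)) = PowerSeries.X := by
    rw [swapHom_C, map_C_X]
  -- After the exchange the outer variable is `v⁻¹`, and modulo `v⁻¹` the polynomial `dPoly c`
  -- becomes `-u⁻¹` whatever `c` is. Hence both poles contribute equally to the coefficient of
  -- `v⁻¹`.
  have hD (c : ℂ) : ∃ s : PowerSeries (PowerSeries A),
      swapHom (dPoly c) = PowerSeries.X * s - PowerSeries.C PowerSeries.X := by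
    refine ⟨1 - c • PowerSeries.C PowerSeries.X, ?_⟩
    have h0 : swapHom (c • (PowerSeries.X * PowerSeries.C PowerSeries.X :
        PowerSeries (PowerSeries A))) =
        PowerSeries.X * c • PowerSeries.C PowerSeries.X := by
      rw [mul_smul_comm]
      ext n m
      rw [coeff_coeff_swapHom]
      simp only [PowerSeries.coeff_smul]
      rw [← coeff_coeff_swapHom, map_mul, hX, hX', (PowerSeries.commute_X _).eq]
    rw [dPoly, map_sub, map_sub, hX, hX', h0, mul_sub, mul_one]
    abel
  obtain ⟨a, ha⟩ := hD 0
  obtain ⟨b, hb⟩ := hD kappa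
  simp only [map_mul swapHom (dPoly _), map_mul swapHom (PowerSeries.X * _),
    map_mul swapHom PowerSeries.X, hX, hX', map_sub, map_sComm, map_rttP, map_rttQ, map_zsmul,
    swapHom_C, swapHom_map_C, map_swapHom_C, map_swapHom_map_C, ha, hb] at e
  set L := sComm (par i + par j) (par k + par l) (PowerSeries.C (t i j))
    (PowerSeries.map PowerSeries.C (t k l)) with hL
  have e0 := congrArg PowerSeries.constantCoeff e
  simp only [map_mul, map_sub, PowerSeries.constantCoeff_X, PowerSeries.constantCoeff_C, zero_mul,
    mul_zero, zero_sub, neg_mul, mul_neg, neg_neg] at e0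
  have L0 : PowerSeries.constantCoeff L = 0 :=
    X_mul_cancel (X_mul_cancel (by rw [e0, mul_zero, mul_zero]))
  have e1 := congrArg (PowerSeries.coeff 1) e
  simp only [coeff_one_mul', map_mul, map_sub, PowerSeries.constantCoeff_X,
    PowerSeries.constantCoeff_C, zero_mul, mul_zero, zero_sub, neg_mul, mul_neg, neg_neg, L0,
    add_zero, map_zsmul, PowerSeries.coeff_one_X, PowerSeries.coeff_C, one_ne_zero, if_false,
    zero_add, mul_one] at e1
  have e2 := X_mul_cancel e1
  rw [smul_neg, sub_neg_eq_add, neg_add_eq_sub, ← mul_smul_comm, ← mul_sub] at e2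
  -- In that coefficient `T(v)` is replaced by its value at `v = ∞`, the identity matrix.
  have m1 : (t.map PowerSeries.C).map PowerSeries.constantCoeff = t := by
    ext
    simp
  have m2 : (t.map (PowerSeries.map PowerSeries.C)).map
      (PowerSeries.constantCoeff : PowerSeries (PowerSeries A) →+* _) = 1 := by
    ext i j n
    rw [Matrix.map_apply, Matrix.map_apply, ← PowerSeries.coeff_zero_eq_constantCoeff_apply,
      PowerSeries.coeff_map, PowerSeries.coeff_zero_eq_constantCoeff_apply, h1]
    rw [Matrix.one_apply, Matrix.one_apply]
    split_ifs <;> simp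
  have e3 := X_mul_cancel e2
  rw [map_rttP, map_rttQ, m1, m2] at e3
  rw [← e3, hL]
  simp only [sComm_eq_zsmul, map_sub, map_zsmul, coeff_one_mul', PowerSeries.constantCoeff_C,
    PowerSeries.coeff_map, PowerSeries.coeff_C, one_ne_zero, if_false, zero_mul, mul_zero,
    add_zero, zero_add]

end Coefficients

/-! ### Relations for the lower triangular factor by transposition -/

section LowerRelations

variable {K B : Type*} [Field K] [CharZero K] [Ring B] [Algebra K B] {d : K} {G G' : GaussData B}

theorem Rtt.gauss_opp (H : Rtt d G.entry G'.entry) : Rtt d G.opp.entry G'.opp.entry := by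
  rw [GaussData.entry_opp, GaussData.entry_opp]
  exact H.opp

theorem Rtt.h₂_f₂₁ (H : Rtt d G.entry G'.entry) (H' : Rtt (-d) G'.entry G.entry) (hd : d ≠ 0)
    (hd1 : d + 1 ≠ 0) (hd2 : d - 1 ≠ 0) (hd4 : d - 3 / 2 ≠ 0) (hd6 : d - 1 / 2 ≠ 0)
    (u : IsUnit G.h₁) (w : IsUnit G.h₂) (u' : IsUnit G'.h₁) :
    G.h₂ * G'.f₂₁ - G'.f₂₁ * G.h₂ =
      (d⁻¹ • (G'.f₂₁ - G.f₂₁) + (d - 1 / 2)⁻¹ • (G.f₃₂ - G'.f₂₁)) * G.h₂ := by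
  have r := congrArg MulOpposite.unop
    (H.gauss_opp.h₂_e₁₂ H'.gauss_opp hd hd1 hd2 hd4 hd6 u.op w.op u'.op)
  simp only [GaussData.opp, MulOpposite.unop_sub, MulOpposite.unop_mul, MulOpposite.unop_op,
    MulOpposite.unop_add, MulOpposite.unop_smul] at r
  linear_combination (norm := skip) -r
  simp only [add_mul, sub_mul, smul_mul_assoc, neg_mul]
  module

theorem Rtt.f₂₁_f₂₁ (H : Rtt d G.entry G'.entry) (H' : Rtt (-d) G'.entry G.entry) (hd : d ≠ 0)
    (hd1 : d + 1 ≠ 0) (hd2 : d - 1 ≠ 0) (hd3 : d + 3 / 2 ≠ 0) (hd5 : d + 1 / 2 ≠ 0)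
    (u : IsUnit G.h₁) (u' : IsUnit G'.h₁) :
    G'.f₂₁ * G.f₂₁ + G.f₂₁ * G'.f₂₁ =
      d⁻¹ • (G'.f₃₁ - G.f₃₁) + d⁻¹ • (G.f₂₁ ^ 2 - G'.f₂₁ ^ 2) +
        (1 / 2 * d⁻¹) • (G'.f₂₁ * G.f₂₁ - G.f₂₁ * G'.f₂₁) -
        (1 / 2 * d⁻¹ ^ 2) • (G'.f₂₁ - G.f₂₁) ^ 2 := by
  have r := congrArg MulOpposite.unop
    (H.gauss_opp.e₁₂_e₁₂ H'.gauss_opp hd hd1 hd2 hd3 hd5 u.op u'.op)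
  simp only [GaussData.opp, MulOpposite.unop_sub, MulOpposite.unop_mul, MulOpposite.unop_op,
    MulOpposite.unop_add, MulOpposite.unop_smul, MulOpposite.unop_pow] at r
  linear_combination (norm := skip) r
  simp only [mul_sub, sub_mul, pow_two]
  module

theorem Rtt.f₂₁_f₃₁_aux (H : Rtt d G.entry G'.entry) (H' : Rtt (-d) G'.entry G.entry) (hd : d ≠ 0)
    (hd1 : d + 1 ≠ 0) (hd2 : d - 1 ≠ 0) (hd3 : d + 3 / 2 ≠ 0) (hd5 : d + 1 / 2 ≠ 0)
    (u : IsUnit G.h₁) (u' : IsUnit G'.h₁) :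
    (d + 1) • (((d - 1) * (d + 1 / 2)) • (G'.f₃₁ * G.f₂₁) + (d + 1 / 2) • (G'.f₃₁ * G'.f₂₁) -
      (d + 1 / 2) • (G.f₃₁ * G'.f₂₁) - (d * (d + 3 / 2)) • (G.f₂₁ * G'.f₃₁) +
      (2 * d + 1 / 2) • (G.f₂₁ * G.f₃₁) + d • (G.f₂₁ ^ 2 * G'.f₂₁) + G.f₂₁ ^ 3) =
    (d + 1 / 2) • (G.f₂₁ * G.f₃₁ - G.f₃₁ * G.f₂₁ + (2 : K) • G.f₂₁ ^ 3) := by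
  have r := congrArg MulOpposite.unop
    (H.gauss_opp.e₁₂_e₁₃_aux H'.gauss_opp hd hd1 hd2 hd3 hd5 u.op u'.op)
  simp only [GaussData.opp, MulOpposite.unop_sub, MulOpposite.unop_mul, MulOpposite.unop_op,
    MulOpposite.unop_add, MulOpposite.unop_smul, MulOpposite.unop_pow] at r
  linear_combination (norm := skip) -r
  simp only [neg_mul, mul_neg]
  module

end LowerRelations

/-! ### One-parameter consequences of the commutators with `t₁₂⁽¹⁾` and `t₂₁⁽¹⁾` -/

section OneVariable

variable {R : Type*} [Ring R] {G : GaussData R} {x : R}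

theorem GaussData.entry_two_zero : G.entry 2 0 = G.f₃₁ * G.h₁ := rfl
theorem GaussData.entry_two_one : G.entry 2 1 = G.f₃₁ * G.h₁ * G.e₁₂ + G.f₃₂ * G.h₂ := rfl
theorem GaussData.entry_two_two :
    G.entry 2 2 = G.f₃₁ * G.h₁ * G.e₁₃ + G.f₃₂ * G.h₂ * G.e₂₃ + G.h₃ := rfl

/-- `x` has the commutation relations of `t_{21}^{(1)}`. -/
def CommLikeLower (t : Matrix (Fin 3) (Fin 3) R) (x : R) : Prop :=
  ∀ i j : Fin 3, sComm (par i + par j) 1 (t i j) x =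
    rttQ t 1 i j 1 0 - rttSign i j 1 • rttP t 1 i j 1 0

/-- `x` has the commutation relations of `t_{12}^{(1)}`. -/
def CommLikeUpper (t : Matrix (Fin 3) (Fin 3) R) (x : R) : Prop :=
  ∀ i j : Fin 3, sComm (par i + par j) 1 (t i j) x =
    rttQ t 1 i j 0 1 - rttSign i j 0 • rttP t 1 i j 0 1

theorem CommLikeUpper.h₁ (H : CommLikeUpper G.entry x) :
    G.h₁ * x - x * G.h₁ = -(G.h₁ * G.e₁₂) := by
  have r := H 0 0
  simp only [sComm, rttP, rttQ, rttSign, par_zero, par_one, par_two, theta_zero, theta_one,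
    theta_two, rev_zero, rev_one, rev_two, Fin.sum_univ_three, GaussData.entry_zero_zero,
    GaussData.entry_zero_one, GaussData.entry_zero_two, GaussData.entry_one_zero,
    GaussData.entry_one_one, GaussData.entry_one_two, GaussData.entry_two_zero,
    GaussData.entry_two_one, GaussData.entry_two_two, Matrix.one_apply, Fin.reduceEq, if_true,
    if_false] at r
  norm_num at r
  linear_combination (norm := noncomm_ring) r

theorem CommLikeUpper.h₁_mul_e₁₂ (H : CommLikeUpper G.entry x) :
    G.h₁ * G.e₁₂ * x + x * (G.h₁ * G.e₁₂) = -(G.h₁ * G.e₁₃) := by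
  have r := H 0 1
  simp only [sComm, rttP, rttQ, rttSign, par_zero, par_one, par_two, theta_zero, theta_one,
    theta_two, rev_zero, rev_one, rev_two, Fin.sum_univ_three, GaussData.entry_zero_zero,
    GaussData.entry_zero_one, GaussData.entry_zero_two, GaussData.entry_one_zero,
    GaussData.entry_one_one, GaussData.entry_one_two, GaussData.entry_two_zero,
    GaussData.entry_two_one, GaussData.entry_two_two, Matrix.one_apply, Fin.reduceEq, if_true,
    if_false] at r
  norm_num at r
  linear_combination (norm := noncomm_ring) r

theorem CommLikeUpper.e₁₃_eq (H : CommLikeUpper G.entry x) (u : IsUnit G.h₁) :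
    G.e₁₃ = -G.e₁₂ ^ 2 - (G.e₁₂ * x + x * G.e₁₂) := by
  refine u.mul_left_cancel ?_
  linear_combination (norm := noncomm_ring) H.h₁_mul_e₁₂ + H.h₁ * G.e₁₂

theorem CommLikeLower.h₁ (H : CommLikeLower G.entry x) :
    G.h₁ * x - x * G.h₁ = G.f₂₁ * G.h₁ := by
  have r := H 0 0
  simp only [sComm, rttP, rttQ, rttSign, par_zero, par_one, par_two, theta_zero, theta_one,
    theta_two, rev_zero, rev_one, rev_two, Fin.sum_univ_three, GaussData.entry_zero_zero,
    GaussData.entry_zero_one, GaussData.entry_zero_two, GaussData.entry_one_zero,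
    GaussData.entry_one_one, GaussData.entry_one_two, GaussData.entry_two_zero,
    GaussData.entry_two_one, GaussData.entry_two_two, Matrix.one_apply, Fin.reduceEq, if_true,
    if_false] at r
  norm_num at r
  linear_combination (norm := noncomm_ring) r

theorem CommLikeLower.t₁₂ (H : CommLikeLower G.entry x) :
    G.h₁ * G.e₁₂ * x + x * (G.h₁ * G.e₁₂) = G.h₁ - (G.f₂₁ * G.h₁ * G.e₁₂ + G.h₂) := by
  have r := H 0 1
  simp only [sComm, rttP, rttQ, rttSign, par_zero, par_one, par_two, theta_zero, theta_one,
    theta_two, rev_zero, rev_one, rev_two, Fin.sum_univ_three, GaussData.entry_zero_zero,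
    GaussData.entry_zero_one, GaussData.entry_zero_two, GaussData.entry_one_zero,
    GaussData.entry_one_one, GaussData.entry_one_two, GaussData.entry_two_zero,
    GaussData.entry_two_one, GaussData.entry_two_two, Matrix.one_apply, Fin.reduceEq, if_true,
    if_false] at r
  norm_num at r
  linear_combination (norm := noncomm_ring) r

theorem CommLikeLower.t₁₃ (H : CommLikeLower G.entry x) :
    G.h₁ * G.e₁₃ * x - x * (G.h₁ * G.e₁₃) =
      G.f₂₁ * G.h₁ * G.e₁₃ + G.h₂ * G.e₂₃ - G.h₁ * G.e₁₂ := by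
  have r := H 0 2
  simp only [sComm, rttP, rttQ, rttSign, par_zero, par_one, par_two, theta_zero, theta_one,
    theta_two, rev_zero, rev_one, rev_two, Fin.sum_univ_three, GaussData.entry_zero_zero,
    GaussData.entry_zero_one, GaussData.entry_zero_two, GaussData.entry_one_zero,
    GaussData.entry_one_one, GaussData.entry_one_two, GaussData.entry_two_zero,
    GaussData.entry_two_one, GaussData.entry_two_two, Matrix.one_apply, Fin.reduceEq, if_true,
    if_false] at r
  norm_num at r
  linear_combination (norm := noncomm_ring) r

theorem CommLikeLower.t₂₁ (H : CommLikeLower G.entry x) :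
    G.f₂₁ * G.h₁ * x + x * (G.f₂₁ * G.h₁) = G.f₃₁ * G.h₁ := by
  have r := H 1 0
  simp only [sComm, rttP, rttQ, rttSign, par_zero, par_one, par_two, theta_zero, theta_one,
    theta_two, rev_zero, rev_one, rev_two, Fin.sum_univ_three, GaussData.entry_zero_zero,
    GaussData.entry_zero_one, GaussData.entry_zero_two, GaussData.entry_one_zero,
    GaussData.entry_one_one, GaussData.entry_one_two, GaussData.entry_two_zero,
    GaussData.entry_two_one, GaussData.entry_two_two, Matrix.one_apply, Fin.reduceEq, if_true,
    if_false] at r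
  norm_num at r
  linear_combination (norm := noncomm_ring) r

theorem CommLikeLower.t₂₂ (H : CommLikeLower G.entry x) :
    (G.f₂₁ * G.h₁ * G.e₁₂ + G.h₂) * x - x * (G.f₂₁ * G.h₁ * G.e₁₂ + G.h₂) =
      G.f₂₁ * G.h₁ - (G.f₃₁ * G.h₁ * G.e₁₂ + G.f₃₂ * G.h₂) := by
  have r := H 1 1
  simp only [sComm, rttP, rttQ, rttSign, par_zero, par_one, par_two, theta_zero, theta_one,
    theta_two, rev_zero, rev_one, rev_two, Fin.sum_univ_three, GaussData.entry_zero_zero,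
    GaussData.entry_zero_one, GaussData.entry_zero_two, GaussData.entry_one_zero,
    GaussData.entry_one_one, GaussData.entry_one_two, GaussData.entry_two_zero,
    GaussData.entry_two_one, GaussData.entry_two_two, Matrix.one_apply, Fin.reduceEq, if_true,
    if_false] at r
  norm_num at r
  linear_combination (norm := noncomm_ring) r

theorem CommLikeLower.t₂₃ (H : CommLikeLower G.entry x) :
    (G.f₂₁ * G.h₁ * G.e₁₃ + G.h₂ * G.e₂₃) * x + x * (G.f₂₁ * G.h₁ * G.e₁₃ + G.h₂ * G.e₂₃) =
      G.f₃₁ * G.h₁ * G.e₁₃ + G.f₃₂ * G.h₂ * G.e₂₃ + G.h₃ -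
        (G.f₂₁ * G.h₁ * G.e₁₂ + G.h₂) := by
  have r := H 1 2
  simp only [sComm, rttP, rttQ, rttSign, par_zero, par_one, par_two, theta_zero, theta_one,
    theta_two, rev_zero, rev_one, rev_two, Fin.sum_univ_three, GaussData.entry_zero_zero,
    GaussData.entry_zero_one, GaussData.entry_zero_two, GaussData.entry_one_zero,
    GaussData.entry_one_one, GaussData.entry_one_two, GaussData.entry_two_zero,
    GaussData.entry_two_one, GaussData.entry_two_two, Matrix.one_apply, Fin.reduceEq, if_true,
    if_false] at r
  norm_num at r
  linear_combination (norm := noncomm_ring) r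

theorem CommLikeLower.f₃₁_eq (H : CommLikeLower G.entry x) (u : IsUnit G.h₁) :
    G.f₃₁ = G.f₂₁ ^ 2 + (G.f₂₁ * x + x * G.f₂₁) := by
  refine u.mul_right_cancel ?_
  linear_combination (norm := noncomm_ring) -H.t₂₁ + G.f₂₁ * H.h₁

/-- Expresses `h₁⁻¹h₂` as one minus an anticommutator; both the formula for `h₃` and the
commutativity of `h₂` rest on this. -/
theorem CommLikeLower.e₁₂ (H : CommLikeLower G.entry x) :
    G.h₁ * (G.e₁₂ * x + x * G.e₁₂) = G.h₁ - G.h₂ := by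
  linear_combination (norm := noncomm_ring) H.t₁₂ + H.h₁ * G.e₁₂

theorem CommLikeLower.e₁₃ (H : CommLikeLower G.entry x) :
    G.h₁ * (G.e₁₃ * x - x * G.e₁₃) = G.h₂ * G.e₂₃ - G.h₁ * G.e₁₂ := by
  linear_combination (norm := noncomm_ring) H.t₁₃ - H.h₁ * G.e₁₃

theorem CommLikeLower.h₂ (H : CommLikeLower G.entry x) :
    G.h₂ * x - x * G.h₂ = (G.f₂₁ - G.f₃₂) * G.h₂ := by
  linear_combination (norm := noncomm_ring) H.t₂₂ - G.f₂₁ * H.e₁₂ + H.t₂₁ * G.e₁₂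

/-- The analogue of `CommLikeLower.e₁₂` one step down the diagonal, and the source of `h₃`. -/
theorem CommLikeLower.e₂₃ (H : CommLikeLower G.entry x) :
    G.h₂ * (G.e₂₃ * x + x * G.e₂₃) = G.h₃ - G.h₂ := by
  linear_combination (norm := noncomm_ring) H.t₂₃ - G.f₂₁ * H.e₁₃ - H.t₂₁ * G.e₁₃ + H.h₂ * G.e₂₃

end OneVariable

/-! ### Gauss data over a complex algebra: units, coefficientwise commutation, nonzero scalars -/

/-- The image of Gauss data under a map. -/
def GaussData.map {R S : Type*} (G : GaussData R) (φ : R → S) : GaussData S where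
  f₂₁ := φ G.f₂₁
  f₃₁ := φ G.f₃₁
  f₃₂ := φ G.f₃₂
  h₁ := φ G.h₁
  h₂ := φ G.h₂
  h₃ := φ G.h₃
  e₁₂ := φ G.e₁₂
  e₁₃ := φ G.e₁₃
  e₂₃ := φ G.e₂₃

theorem GaussData.entry_map {R S : Type*} [Ring R] [Ring S] (G : GaussData R) (φ : R →+* S) :
    (G.map φ).entry = G.entry.map φ := by
  ext i j
  fin_cases i <;> fin_cases j <;> simp [GaussData.entry, GaussData.map]

/-- Gauss data of a matrix `1 + O(u⁻¹)` that satisfies the RTT relation. -/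
structure IsRttGauss {A : Type*} [Ring A] [Algebra ℂ A] (G : GaussData (PowerSeries A)) : Prop where
  rtt : Rtt uv (G.entry.map atU) (G.entry.map atV)
  const : ∀ i j, PowerSeries.constantCoeff (G.entry i j) = (1 : Matrix (Fin 3) (Fin 3) A) i j

section Units

variable {A : Type*} [Ring A]

theorem mul_inv_of_const {f : PowerSeries A} (h : PowerSeries.constantCoeff f = 1) :
    f * inv f = 1 := PowerSeries.mul_invOfUnit f 1 (by simpa using h)

theorem inv_mul_of_const {f : PowerSeries A} (h : PowerSeries.constantCoeff f = 1) :
    inv f * f = 1 := PowerSeries.invOfUnit_mul f 1 (by simpa using h)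

theorem isUnit_of_const {f : PowerSeries A} (h : PowerSeries.constantCoeff f = 1) : IsUnit f :=
  ⟨⟨f, inv f, mul_inv_of_const h, inv_mul_of_const h⟩, rfl⟩

end Units

section Commute

theorem commute_of_coeff {A : Type*} [Ring A] {f g : PowerSeries A}
    (h : ∀ m n, Commute (PowerSeries.coeff m f) (PowerSeries.coeff n g)) :
    Commute f g := by
  ext n
  rw [PowerSeries.coeff_mul, PowerSeries.coeff_mul, ← Finset.Nat.sum_antidiagonal_swap]
  exact Finset.sum_congr rfl fun p _ => h _ _

variable {A : Type*} [Ring A] [Algebra ℂ A] {f g : PowerSeries A}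

/-- Independent variables separate coefficients. Coefficientwise commutation survives both `v = u`
and the shift by `1/2`, which the two-parameter identity cannot express directly. -/
theorem commute_coeff_of_commute {A : Type*} [Ring A] {f g : PowerSeries A}
    (h : (atU f : Biseries A) * atV g = atV g * atU f) (m n : ℕ) :
    Commute (PowerSeries.coeff m f) (PowerSeries.coeff n g) := by
  rw [← emb_map_C, ← emb_C, ← map_mul, ← map_mul] at h
  have h1 := congrArg (fun F => PowerSeries.coeff n (PowerSeries.coeff m F)) (emb_injective h)
  rw [commute_iff_eq]
  simpa using h1

theorem commute_shift_of_coeff (c : ℂ)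
    (h : ∀ m n, Commute (PowerSeries.coeff m f) (PowerSeries.coeff n g)) :
    Commute f (shift c g) := by
  refine commute_of_coeff fun m n => ?_
  rw [coeff_shift]
  exact Commute.sum_right _ _ _ fun r _ => (h m r).smul_right _

end Commute

section Scalars

theorem uv_ne_zero : uv ≠ 0 := by rw [uv_eq]; exact uv_sub_ne_zero 0

theorem uv_add_one_ne_zero : uv + 1 ≠ 0 := by
  simpa using uv_sub_ne_zero (-1)

theorem uv_sub_one_ne_zero : uv - 1 ≠ 0 := by
  simpa using uv_sub_ne_zero 1

theorem const_half : Scalars.const (1 / 2) = 1 / 2 := by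
  rw [map_div₀, map_one, map_ofNat]

theorem const_three_halves : Scalars.const (3 / 2) = 3 / 2 := by
  rw [map_div₀, map_ofNat, map_ofNat]

theorem uv_sub_half_ne_zero : uv - 1 / 2 ≠ 0 := by
  rw [← const_half]; exact uv_sub_ne_zero _

theorem uv_add_half_ne_zero : uv + 1 / 2 ≠ 0 := by
  rw [← const_half, ← sub_neg_eq_add, ← map_neg]; exact uv_sub_ne_zero _

theorem uv_sub_three_halves_ne_zero : uv - 3 / 2 ≠ 0 := by
  rw [← const_three_halves]; exact uv_sub_ne_zero _

theorem uv_add_three_halves_ne_zero : uv + 3 / 2 ≠ 0 := by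
  rw [← const_three_halves, ← sub_neg_eq_add, ← map_neg]; exact uv_sub_ne_zero _

end Scalars

/-! ### The entries `e₂₃` and `f₃₂` from the pole at `v = u - 1/2` -/

namespace IsRttGauss

variable {A : Type*} [Ring A] [Algebra ℂ A] {G : GaussData (PowerSeries A)}

theorem gauss_rtt (H : IsRttGauss G) : Rtt uv (G.map atU).entry (G.map atV).entry := by
  rw [GaussData.entry_map, GaussData.entry_map]
  exact H.rtt

theorem gauss_rtt_swap (H : IsRttGauss G) : Rtt (-uv) (G.map atV).entry (G.map atU).entry := by
  rw [GaussData.entry_map, GaussData.entry_map]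
  exact rtt_swap H.rtt

theorem const_h₁ (H : IsRttGauss G) : PowerSeries.constantCoeff G.h₁ = 1 := by
  simpa [GaussData.entry_zero_zero] using H.const 0 0

theorem const_e₁₂ (H : IsRttGauss G) : PowerSeries.constantCoeff G.e₁₂ = 0 := by
  simpa [GaussData.entry_zero_one, H.const_h₁] using H.const 0 1

theorem const_f₂₁ (H : IsRttGauss G) : PowerSeries.constantCoeff G.f₂₁ = 0 := by
  simpa [GaussData.entry_one_zero, H.const_h₁] using H.const 1 0

theorem const_h₂ (H : IsRttGauss G) : PowerSeries.constantCoeff G.h₂ = 1 := by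
  simpa [GaussData.entry_one_one, H.const_e₁₂] using H.const 1 1

theorem isUnit_h₁ (H : IsRttGauss G) : IsUnit G.h₁ := isUnit_of_const H.const_h₁
theorem isUnit_h₂ (H : IsRttGauss G) : IsUnit G.h₂ := isUnit_of_const H.const_h₂
theorem isUnit_atU_h₁ (H : IsRttGauss G) : IsUnit (G.map atU).h₁ := H.isUnit_h₁.map atU
theorem isUnit_atV_h₁ (H : IsRttGauss G) : IsUnit (G.map atV).h₁ := H.isUnit_h₁.map atV
theorem isUnit_atU_h₂ (H : IsRttGauss G) : IsUnit (G.map atU).h₂ := H.isUnit_h₂.map atU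

theorem h₁_h₁ (H : IsRttGauss G) :
    (atU G.h₁ : Biseries A) * atV G.h₁ = atV G.h₁ * atU G.h₁ :=
  H.gauss_rtt.h₁_h₁ uv_ne_zero uv_add_one_ne_zero

theorem h₁_h₂ (H : IsRttGauss G) :
    (atU G.h₁ : Biseries A) * atV G.h₂ = atV G.h₂ * atU G.h₁ :=
  H.gauss_rtt.h₁_h₂ uv_ne_zero uv_add_one_ne_zero H.isUnit_atV_h₁

theorem neg_uv_add_one_ne_zero : -uv + 1 ≠ 0 := fun h =>
  uv_sub_one_ne_zero (by linear_combination -h)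

theorem neg_uv_sub_one_ne_zero : -uv - 1 ≠ 0 := fun h =>
  uv_add_one_ne_zero (by linear_combination -h)

theorem h₂_h₁ (H : IsRttGauss G) :
    (atU G.h₂ : Biseries A) * atV G.h₁ = atV G.h₁ * atU G.h₂ :=
  (H.gauss_rtt_swap.h₁_h₂ (neg_ne_zero.2 uv_ne_zero) neg_uv_add_one_ne_zero H.isUnit_atU_h₁).symm

/-- After division by `h₂(u)`, the left side of the relation with `e₁₂(v)` is a double power series.
The right side has an apparent pole at `v = u - 1/2`, so its residue `e₁₂(u - 1/2) + e₂₃(u)` must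
vanish. -/
theorem e₂₃_eq (H : IsRttGauss G) : G.e₂₃ = -shift (1 / 2) G.e₁₂ := by
  have r := H.gauss_rtt.h₂_e₁₂ H.gauss_rtt_swap uv_ne_zero uv_add_one_ne_zero uv_sub_one_ne_zero
    uv_sub_three_halves_ne_zero uv_sub_half_ne_zero H.isUnit_atU_h₁ H.isUnit_atU_h₂ H.isUnit_atV_h₁
  simp only [GaussData.map] at r
  have hi : (atU (inv G.h₂) : Biseries A) * atU G.h₂ = 1 := by
    rw [← map_mul, inv_mul_of_const H.const_h₂, map_one]
  have r1 := congrArg (fun x => atU (inv G.h₂) * x) r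
  simp only [← mul_assoc, hi, one_mul, mul_sub] at r1
  set k : PowerSeries (PowerSeries A) := PowerSeries.C G.e₁₂ -
    PowerSeries.map PowerSeries.C (inv G.h₂) * PowerSeries.C G.e₁₂ *
      PowerSeries.map PowerSeries.C G.h₂ with hk
  -- With `d = u - v`, clearing denominators gives `e₁₂(v) + e₂₃(u) = 2 (d - 1/2) (d k - e₁₂(u) -
  -- e₂₃(u))`; the doubled terms of the cofactor are this factor `2`.
  refine eq_neg_of_add_eq_zero_right (shift_add_eq_zero_of_emb (1 / 2) 2
    (dPoly 0 * (k + k) - PowerSeries.X * PowerSeries.C PowerSeries.X *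
      (PowerSeries.map PowerSeries.C (G.e₁₂ + G.e₂₃) +
        PowerSeries.map PowerSeries.C (G.e₁₂ + G.e₂₃))) ?_)
  rw [map_sub, emb_dPoly_mul, emb_X_mul_C_X_mul, const_half, hk]
  simp only [map_add, map_sub, map_mul, emb_map_C, emb_C, map_zero, sub_zero]
  have h1 := uv_ne_zero
  have h2 := uv_sub_half_ne_zero
  have h2' : uv * 2 - 1 ≠ 0 := fun h => h2 (by linear_combination h / 2)
  have h2'' : 2 * uv - 1 ≠ 0 := fun h => h2 (by linear_combination h / 2)
  have h3 := invUV_ne_zero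
  linear_combination (norm := skip) -(2 * invUV ^ 2 * (uv - 1 / 2) * uv) • r1
  match_scalars <;> field_simp <;> ring

theorem f₃₂_eq (H : IsRttGauss G) : G.f₃₂ = shift (1 / 2) G.f₂₁ := by
  have r := H.gauss_rtt.h₂_f₂₁ H.gauss_rtt_swap uv_ne_zero uv_add_one_ne_zero uv_sub_one_ne_zero
    uv_sub_three_halves_ne_zero uv_sub_half_ne_zero H.isUnit_atU_h₁ H.isUnit_atU_h₂ H.isUnit_atV_h₁
  simp only [GaussData.map] at r
  have hi : (atU G.h₂ : Biseries A) * atU (inv G.h₂) = 1 := by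
    rw [← map_mul, mul_inv_of_const H.const_h₂, map_one]
  have r1 := congrArg (fun x => x * atU (inv G.h₂)) r
  simp only [mul_assoc, hi, mul_one, sub_mul] at r1
  set k : PowerSeries (PowerSeries A) := PowerSeries.map PowerSeries.C G.h₂ *
    (PowerSeries.C G.f₂₁ * PowerSeries.map PowerSeries.C (inv G.h₂)) -
      PowerSeries.C G.f₂₁ with hk
  -- Here the identity is `f₂₁(v) - f₃₂(u) = 2 (d - 1/2) (f₃₂(u) - f₂₁(u) - d k)`.
  have key : shift (1 / 2) G.f₂₁ + -G.f₃₂ = 0 := shift_add_eq_zero_of_emb (1 / 2) 2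
    (PowerSeries.X * PowerSeries.C PowerSeries.X *
      (PowerSeries.map PowerSeries.C (G.f₃₂ - G.f₂₁) +
        PowerSeries.map PowerSeries.C (G.f₃₂ - G.f₂₁)) - dPoly 0 * (k + k)) (by
    rw [map_sub, emb_dPoly_mul, emb_X_mul_C_X_mul, const_half, hk]
    simp only [map_add, map_sub, map_mul, map_neg, emb_map_C, emb_C, map_zero, sub_zero]
    have h1 := uv_ne_zero
    have h2 := uv_sub_half_ne_zero
    have h2' : uv * 2 - 1 ≠ 0 := fun h => h2 (by linear_combination h / 2)
    have h2'' : 2 * uv - 1 ≠ 0 := fun h => h2 (by linear_combination h / 2)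
    have h3 := invUV_ne_zero
    linear_combination (norm := skip) (2 * invUV ^ 2 * (uv - 1 / 2) * uv) • r1
    match_scalars <;> field_simp <;> ring)
  exact (add_neg_eq_zero.1 key).symm

end IsRttGauss

/-! ### The series `h₃` and commutativity of `h₂` -/

section Jacobi

variable {K B : Type*} [Field K] [Ring B] [Algebra K B]

/-- The commutator of `h` with `{e', x}` when `[h, x]` and `[h, e']` are known. -/
theorem jacobi_commutator {h x s e' W : B} (h1 : h * x - x * h = s * h)
    (h2 : h * e' - e' * h = h * W) :
    h * (e' * x + x * e') - (e' * x + x * e') * h =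
      h * (W * x + x * W) + (e' * s + s * e') * h := by
  linear_combination (norm := noncomm_ring) h2 * x + h1 * e' + e' * h1 + x * h2 - h1 * W + s * h2

end Jacobi

namespace IsRttGauss

variable {A : Type*} [Ring A] [Algebra ℂ A] {G : GaussData (PowerSeries A)}

theorem coeff_one_t₂₁ (H : IsRttGauss G) :
    PowerSeries.coeff 1 (G.entry 1 0) = PowerSeries.coeff 1 G.f₂₁ := by
  rw [GaussData.entry_one_zero, coeff_one_mul', H.const_f₂₁, H.const_h₁, zero_mul, zero_add,
    mul_one]

theorem coeff_one_t₁₂ (H : IsRttGauss G) :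
    PowerSeries.coeff 1 (G.entry 0 1) = PowerSeries.coeff 1 G.e₁₂ := by
  rw [GaussData.entry_zero_one, coeff_one_mul', H.const_e₁₂, H.const_h₁, mul_zero, add_zero,
    one_mul]

theorem commLikeLower (H : IsRttGauss G) :
    CommLikeLower G.entry (PowerSeries.C (PowerSeries.coeff 1 G.f₂₁)) := fun i j => by
  rw [← H.coeff_one_t₂₁]
  exact rtt_coeff_one H.rtt H.const i j 1 0

theorem commLikeUpper (H : IsRttGauss G) :
    CommLikeUpper G.entry (PowerSeries.C (PowerSeries.coeff 1 G.e₁₂)) := fun i j => by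
  rw [← H.coeff_one_t₁₂]
  exact rtt_coeff_one H.rtt H.const i j 0 1

theorem e₁₃_eq (H : IsRttGauss G) : G.e₁₃ = -G.e₁₂ ^ 2 -
    (G.e₁₂ * PowerSeries.C (PowerSeries.coeff 1 G.e₁₂) +
      PowerSeries.C (PowerSeries.coeff 1 G.e₁₂) * G.e₁₂) :=
  H.commLikeUpper.e₁₃_eq H.isUnit_h₁

theorem f₃₁_eq (H : IsRttGauss G) : G.f₃₁ = G.f₂₁ ^ 2 +
    (G.f₂₁ * PowerSeries.C (PowerSeries.coeff 1 G.f₂₁) +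
      PowerSeries.C (PowerSeries.coeff 1 G.f₂₁) * G.f₂₁) :=
  H.commLikeLower.f₃₁_eq H.isUnit_h₁

theorem commute_h₁_h₂_coeff (H : IsRttGauss G) (m n : ℕ) :
    Commute (PowerSeries.coeff m G.h₁) (PowerSeries.coeff n G.h₂) :=
  commute_coeff_of_commute H.h₁_h₂ m n

theorem commute_h₁_h₂ (H : IsRttGauss G) : Commute G.h₁ G.h₂ :=
  commute_of_coeff H.commute_h₁_h₂_coeff

theorem commute_inv {A : Type*} [Ring A] {f g : PowerSeries A} (hf : PowerSeries.constantCoeff f = 1)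
    (h : Commute f g) : Commute (inv f) g := by
  rw [commute_iff_eq]
  calc inv f * g = inv f * g * (f * inv f) := by rw [mul_inv_of_const hf, mul_one]
    _ = inv f * (g * f) * inv f := by simp only [mul_assoc]
    _ = inv f * f * (g * inv f) := by rw [← h.eq]; simp only [mul_assoc]
    _ = g * inv f := by rw [inv_mul_of_const hf, one_mul]

/-- `{e₁₂(u), f₂₁⁽¹⁾} = 1 - h₁(u)⁻¹ h₂(u)`. -/
theorem e₁₂_comm (H : IsRttGauss G) :
    G.e₁₂ * PowerSeries.C (PowerSeries.coeff 1 G.f₂₁) +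
      PowerSeries.C (PowerSeries.coeff 1 G.f₂₁) * G.e₁₂ = 1 - inv G.h₁ * G.h₂ := by
  refine H.isUnit_h₁.mul_left_cancel ?_
  rw [H.commLikeLower.e₁₂, mul_sub, mul_one, ← mul_assoc, mul_inv_of_const H.const_h₁, one_mul]

theorem e₂₃_comm (H : IsRttGauss G) :
    G.e₂₃ * PowerSeries.C (PowerSeries.coeff 1 G.f₂₁) +
      PowerSeries.C (PowerSeries.coeff 1 G.f₂₁) * G.e₂₃ =
        shift (1 / 2) (inv G.h₁ * G.h₂) - 1 := by
  have h := congrArg (shiftHom (1 / 2)) H.e₁₂_comm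
  simp only [map_add, map_mul, map_sub, map_one] at h
  simp only [← map_mul] at h
  simp only [map_mul _ G.e₁₂, map_mul _ (PowerSeries.C _), shiftHom_apply, shift_C] at h
  rw [H.e₂₃_eq, neg_mul, mul_neg, ← neg_add, h, neg_sub]

theorem h₃_eq_mul_shift (H : IsRttGauss G) :
    G.h₃ = G.h₂ * shift (1 / 2) (inv G.h₁ * G.h₂) := by
  have h := H.commLikeLower.e₂₃
  rw [H.e₂₃_comm, mul_sub, mul_one] at h
  exact (sub_left_inj.1 h).symm

/-- `{e₁₂(v), f₂₁(u)}`, where `k = h₁⁻¹ h₂`. -/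
theorem e₁₂_f₂₁_swap (H : IsRttGauss G) :
    (atV G.e₁₂ : Biseries A) * atU G.f₂₁ + atU G.f₂₁ * atV G.e₁₂ =
      uv⁻¹ • (atU (inv G.h₁ * G.h₂) - atV (inv G.h₁ * G.h₂)) := by
  have r := H.gauss_rtt_swap.e₁₂_f₂₁ (by rw [neg_neg]; exact H.gauss_rtt)
    (neg_ne_zero.2 uv_ne_zero) neg_uv_add_one_ne_zero neg_uv_sub_one_ne_zero
    H.isUnit_atV_h₁ H.isUnit_atU_h₁
  refine H.isUnit_atV_h₁.mul_left_cancel (H.isUnit_atU_h₁.mul_right_cancel (r.trans ?_))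
  have h1 : (atV G.h₁ : Biseries A) * atV (inv G.h₁ * G.h₂) = atV G.h₂ := by
    rw [← map_mul, ← mul_assoc, mul_inv_of_const H.const_h₁, one_mul]
  have h2 : (atU (inv G.h₁ * G.h₂) : Biseries A) * atU G.h₁ = atU G.h₂ := by
    rw [← map_mul, mul_assoc, ← H.commute_h₁_h₂.eq, ← mul_assoc, inv_mul_of_const H.const_h₁,
      one_mul]
  simp only [GaussData.map, inv_neg]
  linear_combination (norm := skip) uv⁻¹ • (h1 * atU G.h₁) - uv⁻¹ • (atV G.h₁ * h2) +
    uv⁻¹ • H.h₂_h₁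
  simp only [mul_sub, sub_mul, mul_smul_comm, smul_mul_assoc, mul_assoc]
  module

/-- `{e₁₂(v), f₂₁(u - 1/2)}`. -/
theorem e₁₂_f₃₂_swap (H : IsRttGauss G) :
    (atV G.e₁₂ : Biseries A) * atU G.f₃₂ + atU G.f₃₂ * atV G.e₁₂ =
      (uv - 1 / 2)⁻¹ • (atU (shift (1 / 2) (inv G.h₁ * G.h₂)) - atV (inv G.h₁ * G.h₂)) := by
  have r : dPoly 0 * (PowerSeries.C G.e₁₂ * PowerSeries.map PowerSeries.C G.f₂₁ +
      PowerSeries.map PowerSeries.C G.f₂₁ * PowerSeries.C G.e₁₂) =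
      PowerSeries.X * (PowerSeries.C PowerSeries.X *
        (PowerSeries.map PowerSeries.C (inv G.h₁ * G.h₂) - PowerSeries.C (inv G.h₁ * G.h₂))) := by
    apply emb_injective
    rw [← mul_assoc PowerSeries.X, emb_dPoly_mul, emb_X_mul_C_X_mul, map_add, map_mul, map_mul,
      map_sub, emb_C, emb_C, emb_map_C, emb_map_C, H.e₁₂_f₂₁_swap, map_zero, sub_zero, smul_smul,
      mul_assoc, mul_inv_cancel₀ uv_ne_zero, mul_one]
  -- The substitution `u ↦ u - 1/2` is made on double power series. The factor `1 - u⁻¹/2` clears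
  -- `(u - 1/2)⁻¹` and turns the shifted `u - v` into `u - v - 1/2`.
  have r1 := congrArg (fun x => (1 - algebraMap ℂ (PowerSeries (PowerSeries A)) (1 / 2) *
    PowerSeries.X) * shiftHom (1 / 2) x) r
  have hs : shiftHom (1 / 2) (dPoly 0 : PowerSeries (PowerSeries A)) =
      PowerSeries.C PowerSeries.X - shiftHom (1 / 2) PowerSeries.X := by
    rw [dPoly, zero_smul, sub_zero, map_sub, shiftHom_apply, shift_C]
  have hX := shift_X_mul (A := PowerSeries A) (1 / 2)
  rw [← shiftHom_apply] at hX
  have hD : (1 - algebraMap ℂ (PowerSeries (PowerSeries A)) (1 / 2) * PowerSeries.X) *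
      (PowerSeries.C PowerSeries.X - shiftHom (1 / 2) PowerSeries.X) = dPoly (1 / 2) := by
    rw [mul_sub, hX, sub_mul, one_mul, dPoly, Algebra.smul_def, mul_assoc]
    abel
  simp only [map_mul (shiftHom _) (dPoly 0), map_mul (shiftHom _) PowerSeries.X, hs] at r1
  rw [← mul_assoc, ← mul_assoc, hD, hX] at r1
  simp only [map_add, map_mul (shiftHom (1 / 2)) (PowerSeries.C _), map_sub,
    map_mul (shiftHom (1 / 2)) (PowerSeries.map PowerSeries.C G.f₂₁)] at r1
  simp only [shiftHom_apply, shift_C, shift_map_C, ← H.f₃₂_eq] at r1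
  have r2 := congrArg emb r1
  rw [← mul_assoc PowerSeries.X, emb_dPoly_mul, emb_X_mul_C_X_mul, map_add, map_mul emb, map_mul emb,
    map_sub emb, emb_C, emb_C, emb_map_C, emb_map_C, const_half] at r2
  have h1 := uv_sub_half_ne_zero
  have h2 := invUV_ne_zero
  have r3 := congrArg (fun x => (invUV * (uv - 1 / 2))⁻¹ • x) r2
  simp only [smul_smul] at r3
  rw [inv_mul_cancel₀ (mul_ne_zero h2 h1), one_smul] at r3
  rw [r3]
  congr 1
  field_simp

/-- `(u - v - 1) (u - v + 1/2) [h₂(u), k(v)] = -(u - v) [h₂(u), k(u - 1/2)]` for `k = h₁⁻¹ h₂`. -/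
theorem h₂_comm_aux (H : IsRttGauss G) :
    ((uv - 1) * (uv + 1 / 2)) • ((atU G.h₂ : Biseries A) * atV (inv G.h₁ * G.h₂) -
        atV (inv G.h₁ * G.h₂) * atU G.h₂) =
      -(uv • (atU G.h₂ * atU (shift (1 / 2) (inv G.h₁ * G.h₂)) -
        atU (shift (1 / 2) (inv G.h₁ * G.h₂)) * atU G.h₂)) := by
  set k := inv G.h₁ * G.h₂ with hk
  set x : Biseries A := atU (PowerSeries.C (PowerSeries.coeff 1 G.f₂₁)) with hx
  have hxV : atV (PowerSeries.C (PowerSeries.coeff 1 G.f₂₁)) = x := by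
    rw [hx, ← emb_C, ← emb_map_C, PowerSeries.map_C]
  have a := congrArg (atU : _ →+* Biseries A) H.commLikeLower.h₂
  simp only [map_sub, map_mul, ← hx] at a
  have bV := congrArg (atV : _ →+* Biseries A) H.e₁₂_comm
  rw [map_sub, map_add, map_mul, map_mul, map_one, hxV, ← hk] at bV
  have bU := congrArg (atU : _ →+* Biseries A) H.e₁₂_comm
  rw [map_sub, map_add, map_mul, map_mul, map_one, ← hx, ← hk] at bU
  have bQ := congrArg (atU : _ →+* Biseries A) H.e₂₃_comm
  rw [map_sub, map_add, map_mul, map_mul, map_one, ← hx, ← hk] at bQ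
  have c := H.gauss_rtt.h₂_e₁₂ H.gauss_rtt_swap uv_ne_zero uv_add_one_ne_zero uv_sub_one_ne_zero
    uv_sub_three_halves_ne_zero uv_sub_half_ne_zero H.isUnit_atU_h₁ H.isUnit_atU_h₂ H.isUnit_atV_h₁
  simp only [GaussData.map] at c
  have d := H.e₁₂_f₂₁_swap
  have e := H.e₁₂_f₃₂_swap
  rw [← hk] at d e
  have j := jacobi_commutator (s := atU G.f₂₁ - atU G.f₃₂) (by simpa [sub_mul] using a) c
  rw [bV] at j
  set ks := shift (1 / 2) k with hks
  -- The right side also produces `[h₂(u), k(u)]`, which vanishes because `h₁(u)` and `h₂(u)`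
  -- commute.
  have hkc : (atU G.h₂ : Biseries A) * atU k = atU k * atU G.h₂ := by
    rw [← map_mul, ← map_mul]
    congr 1
    exact (((commute_inv H.const_h₁ H.commute_h₁_h₂).mul_left (Commute.refl _)).eq).symm
  have hW : (uv⁻¹ • (atU G.e₁₂ - atV G.e₁₂) + (uv - 1 / 2)⁻¹ • (atV G.e₁₂ + atU G.e₂₃)) * x +
      x * (uv⁻¹ • (atU G.e₁₂ - atV G.e₁₂) + (uv - 1 / 2)⁻¹ • (atV G.e₁₂ + atU G.e₂₃)) =
      uv⁻¹ • (atV k - atU k) + (uv - 1 / 2)⁻¹ • (atU ks - atV k) := by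
    linear_combination (norm := skip) uv⁻¹ • bU - uv⁻¹ • bV + (uv - 1 / 2)⁻¹ • bV +
      (uv - 1 / 2)⁻¹ • bQ
    simp only [mul_sub, sub_mul, mul_add, add_mul, mul_smul_comm, smul_mul_assoc]
    module
  have hS : (atV G.e₁₂ : Biseries A) * (atU G.f₂₁ - atU G.f₃₂) +
      (atU G.f₂₁ - atU G.f₃₂) * atV G.e₁₂ =
      uv⁻¹ • (atU k - atV k) - (uv - 1 / 2)⁻¹ • (atU ks - atV k) := by
    linear_combination (norm := skip) d - e
    simp only [mul_sub, sub_mul]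
    abel
  rw [hW, hS] at j
  have h1 := uv_ne_zero
  have h2 := uv_sub_half_ne_zero
  have h2' : uv * 2 - 1 ≠ 0 := fun h => h2 (by linear_combination h / 2)
  have h2'' : 2 * uv - 1 ≠ 0 := fun h => h2 (by linear_combination h / 2)
  -- The coefficient of `[h₂(u), k(v)]` is `1 + d⁻¹ - (d - 1/2)⁻¹`, that is, `(d - 1)(d + 1/2)` over
  -- `d (d - 1/2)`.
  linear_combination (norm := skip) -((uv * (uv - 1 / 2)) • j) + (uv - 1 / 2) • hkc
  simp only [mul_sub, sub_mul, mul_add, add_mul, mul_smul_comm, smul_mul_assoc, mul_one, one_mul]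
  match_scalars <;> field_simp <;> ring

/-- At `v = u - 1` the left side of `h₂_comm_aux` vanishes while the factor `u - v` is `1`. Hence
`[h₂(u), k(u - 1/2)] = 0`, and the right side is zero for all `v`. -/
theorem h₂_comm_k (H : IsRttGauss G) :
    (atU G.h₂ : Biseries A) * atV (inv G.h₁ * G.h₂) = atV (inv G.h₁ * G.h₂) * atU G.h₂ := by
  have r := H.h₂_comm_aux
  set k := inv G.h₁ * G.h₂ with hk
  have h3 := invUV_ne_zero
  have w : shift 1 (0 : PowerSeries A) +
      (G.h₂ * shift (1 / 2) k - shift (1 / 2) k * G.h₂) = 0 := by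
    refine shift_add_eq_zero_of_emb 1 2 (-(PowerSeries.X * PowerSeries.C PowerSeries.X *
      PowerSeries.map PowerSeries.C (G.h₂ * shift (1 / 2) k - shift (1 / 2) k * G.h₂) +
      dPoly (-(1 / 2)) * (PowerSeries.map PowerSeries.C G.h₂ * PowerSeries.C k -
        PowerSeries.C k * PowerSeries.map PowerSeries.C G.h₂))) ?_
    rw [map_neg, map_add, emb_dPoly_mul, emb_X_mul_C_X_mul, map_neg, const_half, sub_neg_eq_add]
    simp only [map_add, map_sub, map_mul, emb_map_C, emb_C, map_zero, map_one]
    linear_combination (norm := skip) (invUV ^ 2) • r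
    match_scalars <;> ring
  rw [← shiftHom_apply, map_zero, zero_add] at w
  rw [← map_mul, ← map_mul, ← map_sub, w, map_zero] at r
  have r0 : ((uv - 1) * (uv + 1 / 2)) • ((atU G.h₂ : Biseries A) * atV k - atV k * atU G.h₂) =
      0 := by
    linear_combination (norm := module) r
  exact sub_eq_zero.1 ((smul_eq_zero_iff_right
    (mul_ne_zero uv_sub_one_ne_zero uv_add_half_ne_zero)).1 r0)

theorem h₂_h₂ (H : IsRttGauss G) :
    (atU G.h₂ : Biseries A) * atV G.h₂ = atV G.h₂ * atU G.h₂ := by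
  have h : (atV G.h₂ : Biseries A) = atV G.h₁ * atV (inv G.h₁ * G.h₂) := by
    rw [← map_mul, ← mul_assoc, mul_inv_of_const H.const_h₁, one_mul]
  rw [h, ← mul_assoc, H.h₂_h₁, mul_assoc, H.h₂_comm_k, mul_assoc]

theorem constantCoeff_shift (c : ℂ) (f : PowerSeries A) :
    PowerSeries.constantCoeff (shift c f) = PowerSeries.constantCoeff f := by
  rw [← PowerSeries.coeff_zero_eq_constantCoeff_apply, coeff_shift]
  simp

theorem shift_inv (c : ℂ) {f : PowerSeries A} (h : PowerSeries.constantCoeff f = 1) :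
    shift c (inv f) = inv (shift c f) := by
  refine left_inv_eq_right_inv (a := shift c f) ?_
    (mul_inv_of_const (by rw [constantCoeff_shift, h]))
  rw [← shift_mul, inv_mul_of_const h]
  exact map_one (shiftHom c)

theorem h₃_eq (H : IsRttGauss G) :
    G.h₃ = inv (shift (1 / 2) G.h₁) * shift (1 / 2) G.h₂ * G.h₂ := by
  have c1 : Commute G.h₂ (shift (1 / 2) G.h₁) :=
    commute_shift_of_coeff _ fun m n => (H.commute_h₁_h₂_coeff n m).symm
  have c2 : Commute G.h₂ (shift (1 / 2) G.h₂) :=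
    commute_shift_of_coeff _ (commute_coeff_of_commute H.h₂_h₂)
  have hc : PowerSeries.constantCoeff (shift (1 / 2) G.h₁) = 1 := by
    rw [constantCoeff_shift, H.const_h₁]
  rw [H.h₃_eq_mul_shift, shift_mul, shift_inv _ H.const_h₁]
  exact (((commute_inv hc c1.symm).symm).mul_right c2).eq

end IsRttGauss

/-! ### The cubic relations -/

namespace IsRttGauss

variable {A : Type*} [Ring A] [Algebra ℂ A] {G : GaussData (PowerSeries A)}

/-- Specialization of `Rtt.e₁₂_e₁₃_aux` at `v = u + 1`: the factor `d + 1` vanishes there and `d +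
1/2` does not. -/
theorem e₁₃_e₁₂ (H : IsRttGauss G) :
    G.e₁₃ * G.e₁₂ - G.e₁₂ * G.e₁₃ - (G.e₁₂ ^ 3 + G.e₁₂ ^ 3) = 0 := by
  have r := H.gauss_rtt.e₁₂_e₁₃_aux H.gauss_rtt_swap uv_ne_zero uv_add_one_ne_zero
    uv_sub_one_ne_zero uv_add_three_halves_ne_zero uv_add_half_ne_zero H.isUnit_atU_h₁
    H.isUnit_atV_h₁
  simp only [GaussData.map] at r
  set eU := PowerSeries.map PowerSeries.C G.e₁₂ with heU
  set aU := PowerSeries.map PowerSeries.C G.e₁₃ with haU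
  set eV := PowerSeries.C G.e₁₂ with heV
  set aV := PowerSeries.C G.e₁₃ with haV
  set XY : PowerSeries (PowerSeries A) := PowerSeries.X * PowerSeries.C PowerSeries.X with hXY
  set F := XY * (XY * (aU * eU - eU * aU - (eU ^ 3 + eU ^ 3))) -
    (dPoly 1 * (dPoly (-(1 / 2)) * (eU * aV)) + XY * (dPoly (-(1 / 2)) * (eV * aV - eV * aU)) -
      dPoly 0 * (dPoly (-(3 / 2)) * (aV * eU)) + XY * (dPoly 0 * (aU * eU)) +
      XY * (dPoly (-(1 / 2)) * (aU * eU)) - XY * (dPoly 0 * (eV * eU ^ 2)) -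
      XY * (XY * eU ^ 3)) with hF
  have w : shift (-1) (0 : PowerSeries A) +
      (G.e₁₃ * G.e₁₂ - G.e₁₂ * G.e₁₃ - (G.e₁₂ ^ 3 + G.e₁₂ ^ 3)) = 0 := by
    -- The defect is isolated by `2 (d + 1) - 2 (d + 1/2) = 1`, hence `F + F`.
    refine shift_add_eq_zero_of_emb (-1) 3 (F + F) ?_
    simp only [hF, map_add, map_sub, emb_dPoly_mul, hXY, emb_X_mul_C_X_mul, map_neg, map_zero,
      map_one, const_half, const_three_halves, sub_neg_eq_add, sub_zero]
    simp only [heU, haU, heV, haV, map_mul, map_pow, map_sub, emb_map_C, emb_C]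
    have h1 := invUV_ne_zero
    linear_combination (norm := skip) (2 * invUV ^ 3) • r
    simp only [mul_sub, sub_mul]
    match_scalars <;> field_simp <;> ring
  rwa [← shiftHom_apply, map_zero, zero_add] at w

theorem f₃₁_f₂₁ (H : IsRttGauss G) :
    G.f₂₁ * G.f₃₁ - G.f₃₁ * G.f₂₁ + (G.f₂₁ ^ 3 + G.f₂₁ ^ 3) = 0 := by
  have r := H.gauss_rtt.f₂₁_f₃₁_aux H.gauss_rtt_swap uv_ne_zero uv_add_one_ne_zero
    uv_sub_one_ne_zero uv_add_three_halves_ne_zero uv_add_half_ne_zero H.isUnit_atU_h₁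
    H.isUnit_atV_h₁
  simp only [GaussData.map] at r
  set eU := PowerSeries.map PowerSeries.C G.f₂₁ with heU
  set aU := PowerSeries.map PowerSeries.C G.f₃₁ with haU
  set eV := PowerSeries.C G.f₂₁ with heV
  set aV := PowerSeries.C G.f₃₁ with haV
  set XY : PowerSeries (PowerSeries A) := PowerSeries.X * PowerSeries.C PowerSeries.X with hXY
  set F := XY * (XY * (eU * aU - aU * eU + (eU ^ 3 + eU ^ 3))) -
    (dPoly 1 * (dPoly (-(1 / 2)) * (aV * eU)) + XY * (dPoly (-(1 / 2)) * (aV * eV - aU * eV)) -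
      dPoly 0 * (dPoly (-(3 / 2)) * (eU * aV)) + XY * (dPoly 0 * (eU * aU)) +
      XY * (dPoly (-(1 / 2)) * (eU * aU)) + XY * (dPoly 0 * (eU ^ 2 * eV)) +
      XY * (XY * eU ^ 3)) with hF
  have w : shift (-1) (0 : PowerSeries A) +
      (G.f₂₁ * G.f₃₁ - G.f₃₁ * G.f₂₁ + (G.f₂₁ ^ 3 + G.f₂₁ ^ 3)) = 0 := by
    refine shift_add_eq_zero_of_emb (-1) 3 (F + F) ?_
    simp only [hF, map_add, map_sub, emb_dPoly_mul, hXY, emb_X_mul_C_X_mul, map_neg, map_zero,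
      map_one, const_half, const_three_halves, sub_neg_eq_add, sub_zero]
    simp only [heU, haU, heV, haV, map_mul, map_pow, map_sub, map_add, emb_map_C, emb_C]
    have h1 := invUV_ne_zero
    linear_combination (norm := skip) (2 * invUV ^ 3) • r
    match_scalars <;> field_simp <;> ring
  rwa [← shiftHom_apply, map_zero, zero_add] at w

theorem e₁₂_e₁₃ (H : IsRttGauss G) :
    ((uv - 1) * (uv + 1 / 2)) • (atU G.e₁₂ * atV G.e₁₃ : Biseries A) +
      (uv + 1 / 2) • (atV G.e₁₂ * atV G.e₁₃) - (uv + 1 / 2) • (atV G.e₁₂ * atU G.e₁₃) -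
      (uv * (uv + 3 / 2)) • (atV G.e₁₃ * atU G.e₁₂) +
      (2 * uv + 1 / 2) • (atU G.e₁₃ * atU G.e₁₂) - uv • (atV G.e₁₂ * atU G.e₁₂ ^ 2) -
      atU G.e₁₂ ^ 3 = 0 := by
  have r := H.gauss_rtt.e₁₂_e₁₃_aux H.gauss_rtt_swap uv_ne_zero uv_add_one_ne_zero
    uv_sub_one_ne_zero uv_add_three_halves_ne_zero uv_add_half_ne_zero H.isUnit_atU_h₁
    H.isUnit_atV_h₁
  have w := congrArg (atU : _ →+* Biseries A) H.e₁₃_e₁₂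
  simp only [map_sub, map_add, map_mul, map_pow, map_zero] at w
  simp only [GaussData.map] at r
  refine (smul_eq_zero_iff_right uv_add_one_ne_zero).1 (r.trans ?_)
  linear_combination (norm := module) (uv + 1 / 2) • w

theorem f₂₁_f₃₁ (H : IsRttGauss G) :
    ((uv - 1) * (uv + 1 / 2)) • (atV G.f₃₁ * atU G.f₂₁ : Biseries A) +
      (uv + 1 / 2) • (atV G.f₃₁ * atV G.f₂₁) - (uv + 1 / 2) • (atU G.f₃₁ * atV G.f₂₁) -
      (uv * (uv + 3 / 2)) • (atU G.f₂₁ * atV G.f₃₁) +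
      (2 * uv + 1 / 2) • (atU G.f₂₁ * atU G.f₃₁) + uv • (atU G.f₂₁ ^ 2 * atV G.f₂₁) +
      atU G.f₂₁ ^ 3 = 0 := by
  have r := H.gauss_rtt.f₂₁_f₃₁_aux H.gauss_rtt_swap uv_ne_zero uv_add_one_ne_zero
    uv_sub_one_ne_zero uv_add_three_halves_ne_zero uv_add_half_ne_zero H.isUnit_atU_h₁
    H.isUnit_atV_h₁
  have w := congrArg (atU : _ →+* Biseries A) H.f₃₁_f₂₁
  simp only [map_sub, map_add, map_mul, map_pow, map_zero] at w
  simp only [GaussData.map] at r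
  refine (smul_eq_zero_iff_right uv_add_one_ne_zero).1 (r.trans ?_)
  linear_combination (norm := module) (uv + 1 / 2) • w

theorem e₁₂_f₂₁ (H : IsRttGauss G) :
    (atU G.e₁₂ : Biseries A) * atV G.f₂₁ + atV G.f₂₁ * atU G.e₁₂ =
      uv⁻¹ • (atU (inv G.h₁) * atU G.h₂ - atV (inv G.h₁) * atV G.h₂) := by
  have r := H.gauss_rtt.e₁₂_f₂₁ H.gauss_rtt_swap uv_ne_zero uv_add_one_ne_zero uv_sub_one_ne_zero
    H.isUnit_atU_h₁ H.isUnit_atV_h₁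
  refine H.isUnit_atU_h₁.mul_left_cancel (H.isUnit_atV_h₁.mul_right_cancel (r.trans ?_))
  have h1 : (atU G.h₁ : Biseries A) * (atU (inv G.h₁) * atU G.h₂) = atU G.h₂ := by
    rw [← map_mul, ← map_mul, ← mul_assoc, mul_inv_of_const H.const_h₁, one_mul]
  have h2 : (atV (inv G.h₁) * atV G.h₂ : Biseries A) * atV G.h₁ = atV G.h₂ := by
    rw [← map_mul, ← map_mul, mul_assoc, ← H.commute_h₁_h₂.eq, ← mul_assoc,
      inv_mul_of_const H.const_h₁, one_mul]
  simp only [GaussData.map]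
  linear_combination (norm := skip) uv⁻¹ • H.h₁_h₂ - uv⁻¹ • (h1 * atV G.h₁) +
    uv⁻¹ • (atU G.h₁ * h2)
  simp only [mul_sub, sub_mul, mul_smul_comm, smul_mul_assoc, mul_assoc]
  module

end IsRttGauss

/-! ### The RTT relation in the Yangian -/

section Yangian

theorem map_tMatrix {A B : Type*} [Ring A] [Ring B] (φ : A →+* B) (t : Fin 3 → Fin 3 → ℕ → A) :
    (tMatrix t).map (PowerSeries.map φ) = tMatrix fun i j s => φ (t i j s) := by
  ext i j n
  simp only [tMatrix, Matrix.map_apply, Matrix.of_apply, map_add, map_mul, PowerSeries.map_X,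
    apply_ite (PowerSeries.map φ), map_one, map_zero]
  congr 3

theorem biMap_rttLeft {A B : Type*} [Ring A] [Ring B] [Algebra ℂ A] [Algebra ℂ B] (φ : A →ₐ[ℂ] B)
    (t : Matrix (Fin 3) (Fin 3) (PowerSeries A)) (i j k l : Fin 3) :
    biMap (φ : A →+* B) (rttLeft t i j k l) =
      rttLeft (t.map (PowerSeries.map (φ : A →+* B))) i j k l := by
  simp only [rttLeft, map_sComm, biMap_atU, biMap_atV, Matrix.map_apply]

theorem rttRight_eq {A : Type*} [Ring A] [Algebra ℂ A]
    (t : Matrix (Fin 3) (Fin 3) (PowerSeries A)) (i j k l : Fin 3) :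
    rttRight t i j k l = (rttSign i j k : Biseries A) * invDiffUV 0 *
      rttP (t.map atU) (t.map atV) i j k l - invDiffUV kappa *
      rttQ (t.map atU) (t.map atV) i j k l := by
  simp only [rttSign, Int.cast_pow, Int.cast_neg, Int.cast_one]
  rfl

theorem biMap_rttRight {A B : Type*} [Ring A] [Ring B] [Algebra ℂ A] [Algebra ℂ B] (φ : A →ₐ[ℂ] B)
    (t : Matrix (Fin 3) (Fin 3) (PowerSeries A)) (i j k l : Fin 3) :
    biMap (φ : A →+* B) (rttRight t i j k l) =
      rttRight (t.map (PowerSeries.map (φ : A →+* B))) i j k l := by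
  have h1 : (t.map atU).map (biMap (φ : A →+* B)) =
      (t.map (PowerSeries.map (φ : A →+* B))).map atU := by
    ext1
    simp [biMap_atU]
  have h2 : (t.map atV).map (biMap (φ : A →+* B)) =
      (t.map (PowerSeries.map (φ : A →+* B))).map atV := by
    ext1
    simp [biMap_atV]
  simp only [rttRight_eq, map_sub, map_mul, map_rttP, map_rttQ, map_intCast, biMap_invDiffUV, h1, h2]

/-- The quotient imposes RTT coefficient by coefficient in the free algebra; applying the quotient
map to coefficients reassembles the series identity. -/
theorem rttLeft_T (i j k l : Fin 3) : rttLeft T i j k l = rttRight T i j k l := by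
  have hT : T = (tMatrix fun i j s => FreeAlgebra.ι ℂ (i, j, s)).map
      (PowerSeries.map (RingQuot.mkAlgHom ℂ Rel : FreeT →+* Yangian)) :=
    (map_tMatrix _ _).symm
  rw [hT, ← biMap_rttLeft, ← biMap_rttRight]
  ext m n
  simp only [biMap, coeff_hahnMap]
  exact RingQuot.mkAlgHom_rel ℂ (Rel.rtt i j k l m n)

theorem isRttGauss_of_isGauss {f₂₁ f₃₁ f₃₂ h₁ h₂ h₃ e₁₂ e₁₃ e₂₃ : PowerSeries Yangian}
    (hG : IsGauss T f₂₁ f₃₁ f₃₂ h₁ h₂ h₃ e₁₂ e₁₃ e₂₃) :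
    IsRttGauss (GaussData.mk f₂₁ f₃₁ f₃₂ h₁ h₂ h₃ e₁₂ e₁₃ e₂₃) := by
  have h : (GaussData.mk f₂₁ f₃₁ f₃₂ h₁ h₂ h₃ e₁₂ e₁₃ e₂₃).entry = T := by
    rw [hG]
    simp [GaussData.entry, Matrix.mul_fin_three, add_assoc]
  constructor
  · rw [h]
    exact rtt_of_rttLeft_eq rttLeft_T
  · intro i j
    rw [h, T, tMatrix, Matrix.of_apply, Matrix.one_apply]
    split_ifs <;> simp

end Yangian

/-! ### Translation between scalar multiplication and the series `diffUV`, `invDiffUV` -/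

section Coefficients

variable {A : Type*} [Ring A]

theorem sComm_zero_left (p : ℕ) (x y : A) : sComm 0 p x y = x * y - y * x := by
  simp [sComm]

theorem sComm_one_one (x y : A) : sComm 1 1 x y = x * y + y * x := by
  simp [sComm]

variable [Algebra ℂ A] (x : Biseries A)

theorem mul_invDiffUV_zero : x * invDiffUV 0 = uv⁻¹ • x := by
  rw [mul_invDiffUV, ← uv_eq]

theorem invDiffUV_zero_mul : invDiffUV 0 * x = uv⁻¹ • x := by
  rw [invDiffUV_mul, ← uv_eq]

theorem mul_invDiffUV_half : x * invDiffUV (1 / 2) = (uv - 1 / 2)⁻¹ • x := by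
  rw [mul_invDiffUV, const_half]

theorem diffUV_zero_mul : diffUV 0 * x = uv • x := by
  rw [diffUV_mul, ← uv_eq]

theorem diffUV_one_mul : diffUV 1 * x = (uv - 1) • x := by
  rw [diffUV_mul, map_one]

theorem diffUV_neg_half_mul : diffUV (-(1 / 2)) * x = (uv + 1 / 2) • x := by
  rw [diffUV_mul, map_neg, const_half, sub_neg_eq_add]

theorem diffUV_neg_three_halves_mul : diffUV (-(3 / 2)) * x = (uv + 3 / 2) • x := by
  rw [diffUV_mul, map_neg, const_three_halves, sub_neg_eq_add]

theorem scal_half_mul : scal (1 / 2) * x = (1 / 2 : Scalars) • x := by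
  rw [scal_mul, const_half]

theorem two_mul_varU_sub_varV_add_half_mul :
    (2 * varU A - 2 * varV A + scal (1 / 2)) * x = (2 * uv + 1 / 2) • x := by
  have h := diffUV_zero_mul x
  rw [diffUV, ← sc_const, map_zero, map_zero, sub_zero] at h
  rw [← mul_sub, add_mul, scal_half_mul, mul_assoc, h, two_mul]
  module

end Coefficients

namespace IsRttGauss

variable {A : Type*} [Ring A] [Algebra ℂ A] {G : GaussData (PowerSeries A)}

theorem sComm_h_h (H : IsRttGauss G) (i j : Fin 2) :
    sComm 0 0 (atU (![G.h₁, G.h₂] i) : Biseries A) (atV (![G.h₁, G.h₂] j)) = 0 := by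
  rw [sComm_zero_left, sub_eq_zero]
  fin_cases i <;> fin_cases j
  · exact H.h₁_h₁
  · exact H.h₁_h₂
  · exact H.h₂_h₁
  · exact H.h₂_h₂

theorem sComm_h₁_e₁₂ (H : IsRttGauss G) : sComm 0 1 (atU G.h₁ : Biseries A) (atV G.e₁₂) =
    atU G.h₁ * (atU G.e₁₂ - atV G.e₁₂) * invDiffUV 0 := by
  have r := H.gauss_rtt.e₁₂_h₁ uv_ne_zero uv_add_one_ne_zero H.isUnit_atV_h₁
  simp only [GaussData.map] at r
  rw [sComm_zero_left, mul_invDiffUV_zero, r]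
  simp only [mul_sub, mul_smul_comm]
  module

theorem sComm_h₁_f₂₁ (H : IsRttGauss G) : sComm 0 1 (atU G.h₁ : Biseries A) (atV G.f₂₁) =
    (atV G.f₂₁ - atU G.f₂₁) * atU G.h₁ * invDiffUV 0 := by
  have r := H.gauss_rtt.h₁_f₂₁ uv_ne_zero uv_add_one_ne_zero H.isUnit_atV_h₁
  simp only [GaussData.map] at r
  rw [sComm_zero_left, mul_invDiffUV_zero, r, add_sub_cancel_left]

theorem sComm_h₂_e₁₂ (H : IsRttGauss G) : sComm 0 1 (atU G.h₂ : Biseries A) (atV G.e₁₂) =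
    atU G.h₂ * ((atU G.e₁₂ - atV G.e₁₂) * invDiffUV 0 +
      (atV G.e₁₂ - atU (shift (1 / 2) G.e₁₂)) * invDiffUV (1 / 2)) := by
  have r := H.gauss_rtt.h₂_e₁₂ H.gauss_rtt_swap uv_ne_zero uv_add_one_ne_zero uv_sub_one_ne_zero
    uv_sub_three_halves_ne_zero uv_sub_half_ne_zero H.isUnit_atU_h₁ H.isUnit_atU_h₂
    H.isUnit_atV_h₁
  simp only [GaussData.map] at r
  rw [sComm_zero_left, mul_invDiffUV_zero, mul_invDiffUV_half, r, H.e₂₃_eq, map_neg,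
    sub_eq_add_neg (atV G.e₁₂)]

theorem sComm_h₂_f₂₁ (H : IsRttGauss G) : sComm 0 1 (atU G.h₂ : Biseries A) (atV G.f₂₁) =
    ((atV G.f₂₁ - atU G.f₂₁) * invDiffUV 0 +
      (atU (shift (1 / 2) G.f₂₁) - atV G.f₂₁) * invDiffUV (1 / 2)) * atU G.h₂ := by
  have r := H.gauss_rtt.h₂_f₂₁ H.gauss_rtt_swap uv_ne_zero uv_add_one_ne_zero uv_sub_one_ne_zero
    uv_sub_three_halves_ne_zero uv_sub_half_ne_zero H.isUnit_atU_h₁ H.isUnit_atU_h₂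
    H.isUnit_atV_h₁
  simp only [GaussData.map] at r
  rw [sComm_zero_left, mul_invDiffUV_zero, mul_invDiffUV_half, r, H.f₃₂_eq]

theorem sComm_e₁₂_f₂₁ (H : IsRttGauss G) : sComm 1 1 (atU G.e₁₂ : Biseries A) (atV G.f₂₁) =
    invDiffUV 0 * (atU (inv G.h₁) * atU G.h₂ - atV (inv G.h₁) * atV G.h₂) := by
  rw [sComm_one_one, invDiffUV_zero_mul]
  exact H.e₁₂_f₂₁

theorem sComm_e₁₂_e₁₂ (H : IsRttGauss G) : sComm 1 1 (atU G.e₁₂ : Biseries A) (atV G.e₁₂) =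
    (atU G.e₁₃ - atV G.e₁₃) * invDiffUV 0 + (atU G.e₁₂ ^ 2 - atV G.e₁₂ ^ 2) * invDiffUV 0 +
      scal (1 / 2) * (atU G.e₁₂ * atV G.e₁₂ - atV G.e₁₂ * atU G.e₁₂) * invDiffUV 0 -
      scal (1 / 2) * (atU G.e₁₂ - atV G.e₁₂) ^ 2 * invDiffUV 0 ^ 2 := by
  have r := H.gauss_rtt.e₁₂_e₁₂ H.gauss_rtt_swap uv_ne_zero uv_add_one_ne_zero uv_sub_one_ne_zero
    uv_add_three_halves_ne_zero uv_add_half_ne_zero H.isUnit_atU_h₁ H.isUnit_atV_h₁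
  simp only [GaussData.map] at r
  rw [sComm_one_one, r, pow_two (invDiffUV 0), ← mul_assoc (scal (1 / 2) * _) (invDiffUV 0)]
  simp only [mul_invDiffUV_zero, scal_half_mul, mul_assoc, smul_smul]
  module

theorem sComm_f₂₁_f₂₁ (H : IsRttGauss G) : sComm 1 1 (atV G.f₂₁ : Biseries A) (atU G.f₂₁) =
    (atV G.f₃₁ - atU G.f₃₁) * invDiffUV 0 + (atU G.f₂₁ ^ 2 - atV G.f₂₁ ^ 2) * invDiffUV 0 +
      scal (1 / 2) * (atV G.f₂₁ * atU G.f₂₁ - atU G.f₂₁ * atV G.f₂₁) * invDiffUV 0 -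
      scal (1 / 2) * (atV G.f₂₁ - atU G.f₂₁) ^ 2 * invDiffUV 0 ^ 2 := by
  have r := H.gauss_rtt.f₂₁_f₂₁ H.gauss_rtt_swap uv_ne_zero uv_add_one_ne_zero uv_sub_one_ne_zero
    uv_add_three_halves_ne_zero uv_add_half_ne_zero H.isUnit_atU_h₁ H.isUnit_atV_h₁
  simp only [GaussData.map] at r
  rw [sComm_one_one, r, pow_two (invDiffUV 0), ← mul_assoc (scal (1 / 2) * _) (invDiffUV 0)]
  simp only [mul_invDiffUV_zero, scal_half_mul, mul_assoc, smul_smul]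
  module

theorem cubic_e (H : IsRttGauss G) :
    diffUV 1 * diffUV (-(1 / 2)) * (atU G.e₁₂ * atV G.e₁₃ : Biseries A) +
      diffUV (-(1 / 2)) * (atV G.e₁₂ * atV G.e₁₃) - diffUV (-(1 / 2)) * (atV G.e₁₂ * atU G.e₁₃) -
      diffUV 0 * diffUV (-(3 / 2)) * (atV G.e₁₃ * atU G.e₁₂) +
      (2 * varU A - 2 * varV A + scal (1 / 2)) * (atU G.e₁₃ * atU G.e₁₂) -
      diffUV 0 * (atV G.e₁₂ * atU G.e₁₂ ^ 2) - atU G.e₁₂ ^ 3 = 0 := by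
  rw [mul_assoc, diffUV_one_mul, mul_assoc (diffUV 0)]
  simp only [diffUV_zero_mul, diffUV_neg_half_mul, diffUV_neg_three_halves_mul,
    two_mul_varU_sub_varV_add_half_mul, smul_smul]
  exact H.e₁₂_e₁₃

theorem cubic_f (H : IsRttGauss G) :
    diffUV 1 * diffUV (-(1 / 2)) * (atV G.f₃₁ * atU G.f₂₁ : Biseries A) +
      diffUV (-(1 / 2)) * (atV G.f₃₁ * atV G.f₂₁) - diffUV (-(1 / 2)) * (atU G.f₃₁ * atV G.f₂₁) -
      diffUV 0 * diffUV (-(3 / 2)) * (atU G.f₂₁ * atV G.f₃₁) +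
      (2 * varU A - 2 * varV A + scal (1 / 2)) * (atU G.f₂₁ * atU G.f₃₁) +
      diffUV 0 * (atU G.f₂₁ ^ 2 * atV G.f₂₁) + atU G.f₂₁ ^ 3 = 0 := by
  rw [mul_assoc, diffUV_one_mul, mul_assoc (diffUV 0)]
  simp only [diffUV_zero_mul, diffUV_neg_half_mul, diffUV_neg_three_halves_mul,
    two_mul_varU_sub_varV_add_half_mul, smul_smul]
  exact H.f₂₁_f₃₁

theorem e₁₃_eq_sComm (H : IsRttGauss G) :
    G.e₁₃ = -G.e₁₂ ^ 2 - sComm 1 1 G.e₁₂ (PowerSeries.C (PowerSeries.coeff 1 G.e₁₂)) := by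
  rw [sComm_one_one]
  exact H.e₁₃_eq

theorem f₃₁_eq_sComm (H : IsRttGauss G) :
    G.f₃₁ = G.f₂₁ ^ 2 + sComm 1 1 G.f₂₁ (PowerSeries.C (PowerSeries.coeff 1 G.f₂₁)) := by
  rw [sComm_one_one]
  exact H.f₃₁_eq

end IsRttGauss

end OSp12

theorem proposition5p7 (f₂₁ f₃₁ f₃₂ h₁ h₂ h₃ e₁₂ e₁₃ e₂₃ : PowerSeries Yangian)
    (hG : IsGauss T f₂₁ f₃₁ f₃₂ h₁ h₂ h₃ e₁₂ e₁₃ e₂₃) :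
    -- `[h_i(u), h_j(v)] = 0`
    (∀ i j : Fin 2, sComm 0 0 (atU (![h₁, h₂] i)) (atV (![h₁, h₂] j)) = 0) ∧
    -- `h₁` with `e₁₂` and `f₂₁`
    (sComm 0 1 (atU h₁) (atV e₁₂) = atU h₁ * (atU e₁₂ - atV e₁₂) * invDiffUV 0) ∧
    (sComm 0 1 (atU h₁) (atV f₂₁) = (atV f₂₁ - atU f₂₁) * atU h₁ * invDiffUV 0) ∧
    -- `h₂` with `e₁₂` and `f₂₁`
    (sComm 0 1 (atU h₂) (atV e₁₂) =
      atU h₂ * ((atU e₁₂ - atV e₁₂) * invDiffUV 0 +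
        (atV e₁₂ - atU (shift (1 / 2) e₁₂)) * invDiffUV (1 / 2))) ∧
    (sComm 0 1 (atU h₂) (atV f₂₁) =
      ((atV f₂₁ - atU f₂₁) * invDiffUV 0 +
        (atU (shift (1 / 2) f₂₁) - atV f₂₁) * invDiffUV (1 / 2)) * atU h₂) ∧
    -- `[e₁₂(u), f₂₁(v)]`
    (sComm 1 1 (atU e₁₂) (atV f₂₁) =
      invDiffUV 0 * (atU (inv h₁) * atU h₂ - atV (inv h₁) * atV h₂)) ∧
    -- `[e₁₂(u), e₁₂(v)]`
    (sComm 1 1 (atU e₁₂) (atV e₁₂) =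
      (atU e₁₃ - atV e₁₃) * invDiffUV 0 + (atU e₁₂ ^ 2 - atV e₁₂ ^ 2) * invDiffUV 0 +
        scal (1 / 2) * (atU e₁₂ * atV e₁₂ - atV e₁₂ * atU e₁₂) * invDiffUV 0 -
        scal (1 / 2) * (atU e₁₂ - atV e₁₂) ^ 2 * invDiffUV 0 ^ 2) ∧
    -- `[f₂₁(v), f₂₁(u)]`
    (sComm 1 1 (atV f₂₁) (atU f₂₁) =
      (atV f₃₁ - atU f₃₁) * invDiffUV 0 + (atU f₂₁ ^ 2 - atV f₂₁ ^ 2) * invDiffUV 0 +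
        scal (1 / 2) * (atV f₂₁ * atU f₂₁ - atU f₂₁ * atV f₂₁) * invDiffUV 0 -
        scal (1 / 2) * (atV f₂₁ - atU f₂₁) ^ 2 * invDiffUV 0 ^ 2) ∧
    -- cubic relation for `e₁₂`, `e₁₃`; here `diffUV c = u - v - c`
    (diffUV 1 * diffUV (-(1 / 2)) * (atU e₁₂ * atV e₁₃) +
        diffUV (-(1 / 2)) * (atV e₁₂ * atV e₁₃) - diffUV (-(1 / 2)) * (atV e₁₂ * atU e₁₃) -
        diffUV 0 * diffUV (-(3 / 2)) * (atV e₁₃ * atU e₁₂) +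
        (2 * varU Yangian - 2 * varV Yangian + scal (1 / 2)) * (atU e₁₃ * atU e₁₂) -
        diffUV 0 * (atV e₁₂ * atU e₁₂ ^ 2) - atU e₁₂ ^ 3 = 0) ∧
    -- cubic relation for `f₂₁`, `f₃₁`
    (diffUV 1 * diffUV (-(1 / 2)) * (atV f₃₁ * atU f₂₁) +
        diffUV (-(1 / 2)) * (atV f₃₁ * atV f₂₁) - diffUV (-(1 / 2)) * (atU f₃₁ * atV f₂₁) -
        diffUV 0 * diffUV (-(3 / 2)) * (atU f₂₁ * atV f₃₁) +
        (2 * varU Yangian - 2 * varV Yangian + scal (1 / 2)) * (atU f₂₁ * atU f₃₁) +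
        diffUV 0 * (atU f₂₁ ^ 2 * atV f₂₁) + atU f₂₁ ^ 3 = 0) ∧
    -- `e₁₃` and `f₃₁`, where `e₁₂⁽¹⁾`, `f₂₁⁽¹⁾` are the coefficients of `u⁻¹`
    (e₁₃ = -e₁₂ ^ 2 - sComm 1 1 e₁₂ (PowerSeries.C (PowerSeries.coeff 1 e₁₂))) ∧
    (f₃₁ = f₂₁ ^ 2 + sComm 1 1 f₂₁ (PowerSeries.C (PowerSeries.coeff 1 f₂₁))) ∧
    -- the remaining entries
    (e₂₃ = -shift (1 / 2) e₁₂) ∧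
    (f₃₂ = shift (1 / 2) f₂₁) ∧
    (h₃ = inv (shift (1 / 2) h₁) * shift (1 / 2) h₂ * h₂) := by
  have H := isRttGauss_of_isGauss hG
  exact ⟨H.sComm_h_h, H.sComm_h₁_e₁₂, H.sComm_h₁_f₂₁, H.sComm_h₂_e₁₂, H.sComm_h₂_f₂₁,
    H.sComm_e₁₂_f₂₁, H.sComm_e₁₂_e₁₂, H.sComm_f₂₁_f₂₁, H.cubic_e, H.cubic_f, H.e₁₃_eq_sComm,
    H.f₃₁_eq_sComm, H.e₂₃_eq, H.f₃₂_eq, H.h₃_eq⟩
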